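/- **Theorem (Secure communication probability).** Let $\lambda_S,\lambda_P\ge 0$, $\alpha>2$, $P_t>0$, $\sigma_S^2\ge 0$, $\beta_S>0$, $r_g\ge 0$, with $\sigma_S^2>0$ or $\lambda_P>0$, and let $x_1\in\mathbb R^2$ be the location of the typical transmitter. Consider the following approximating model of a primary network with secrecy guard zones of radius $r_g$. * The eavesdroppers $\Phi_S=\{y_j\}$ form a homogeneous Poisson point process in $\mathbb R^2$ of density $\lambda_S$. Let $R_e=\inf_j\|x_1-y_j\|$ and $P_{\rm active}=\mathbb P(R_e\ge r_g)$. * The transmitters that can interfere at the eavesdropper $y_j$ are $\{x_{i,j}\}_i$, a homogeneous Poisson point process in $\mathbb R^2$ of density $\lambda_P P_{\rm active}$ (in place of the Poisson hole process of the transmitters of a Poisson process of density $\lambda_P$ that have no eavesdropper within distance $r_g$), and those closer than $r_g$ to the eavesdropper are silent. For a reference point $y$ let $$I_2^{(j)}(y)=\sum_{i:\ \|x_{i,j}-y\|\ge r_g} g_{i,j}\|x_{i,j}-y\|^{-\alpha},\qquad {\rm SINR_S}(y_j)=\frac{P_t\, g_{1,j}\|x_1-y_j\|^{-\alpha}}{P_t\,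 I_2^{(j)}(y_j)+\sigma_S^2}.$$ * All fading gains $g_{1,j}$ (link from $x_1$ to $y_j$) and $g_{i,j}$ (link from $x_{i,j}$ to $y_j$) are exponential with mean $1$. The process $\Phi_S$, the interferer processes $\{x_{i,j}\}_i$ of the different eavesdroppers $j$, and all the gains are mutually independent. (In particular, given $\Phi_S$, the SINRs at the different eavesdroppers are independent.) Let $P_{\rm sec}=\mathbb P\big({\rm SINR_S}(y_j)\le\beta_S\text{ for all }j\ \big|\ R_e\ge r_g\big)$ and, for $s\ge0$, $$\mathcal L_{I_2}(s)=\exp\left(-2\pi\lambda_P P_{\rm active}\int_0^{s r_g^{-\alpha}}\frac{s^{2/\alpha}}{\alpha(1+z)z^{2/\alpha}}\,dz\right),$$ where the upper limit is read as $\infty$ if $r_g=0$. Then $P_{\rm active}=e^{-\pi\lambda_S r_g^2}$. For every $j$ and every $y\in\mathbb R^2$, $I_2^{(j)}(y)<\infty$ almost surely and $\mathbb E[e^{-sI_2^{(j)}(y)}]=\mathcal L_{I_2}(s)$ for all $s\ge0$. The integrals in the formulas above and below converge, and $$P_{\rm sec}=\exp\left(-2\pi\lambda_S\int_{r_g}^\infty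 \exp\left(-\frac{\sigma_S^2\beta_S r^\alpha}{P_t}\right)\mathcal L_{I_2}(\beta_S r^\alpha)\,r\,dr\right).$$ -/

import Mathlib

open MeasureTheory ProbabilityTheory
open scoped ENNReal NNReal Real

/-- The Euclidean plane, in which all nodes are located. -/
abbrev Plane : Type := EuclideanSpace ℝ (Fin 2)

/-- Number of points of the random family `X` (counted with multiplicity) that lie in `B`. -/
noncomputable def pointCount {Ω E ι : Type*} (X : ι → Ω → E) (B : Set E) (ω : Ω) : ℕ∞ :=
  Set.encard {i | X i ω ∈ B}

/-- The random points `X i` form a Poisson point process with intensity measure `μ`: the number of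
points in a measurable set of finite intensity is Poisson distributed, and the numbers of points
in finitely many pairwise disjoint such sets are independent. -/
structure IsPoissonProcess {Ω E ι : Type*} [MeasurableSpace Ω] [MeasurableSpace E]
    (X : ι → Ω → E) (μ : Measure E) (P : Measure Ω) : Prop where
  measurable : ∀ i, Measurable (X i)
  poisson : ∀ B : Set E, MeasurableSet B → μ B ≠ ∞ → ∀ n : ℕ,
    P {ω | pointCount X B ω = n} = poissonMeasure (μ B).toNNReal {n}
  indep : ∀ (n : ℕ) (B : Fin n → Set E), (∀ k, MeasurableSet (B k)) → (∀ k, μ (B k) ≠ ∞) →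
    Pairwise (fun k l => Disjoint (B k) (B l)) → iIndepFun (fun k => pointCount X (B k)) P

/-- Homogeneous Poisson point process in the plane with density `lam`. -/
def IsHomogeneousPPP {Ω ι : Type*} [MeasurableSpace Ω]
    (X : ι → Ω → Plane) (lam : ℝ) (P : Measure Ω) : Prop :=
  IsPoissonProcess X (ENNReal.ofReal lam • (volume : Measure Plane)) P

/-- Normalized interference (transmission power `1`) at a receiver in `y`, caused by transmitters
at `X i` with fading gains `g i`, path-loss exponent `α`. Only transmitters at distance at least
`rg` from `y` are active. -/
noncomputable def interference {κ : Type*} (α rg : ℝ) (y : Plane) (X : κ → Plane) (g : κ → ℝ) :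
    ℝ≥0∞ :=
  ∑' i, {i | ENNReal.ofReal rg ≤ edist (X i) y}.indicator
    (fun i => ENNReal.ofReal (g i) * edist (X i) y ^ (-α)) i

/-- SINR at a receiver in `y` of the signal sent with power `Pt` from `x₁` over a link with fading
gain `g₁`, when the noise power is `σ2` and the normalized interference is `I`. -/
noncomputable def sinr (α Pt σ2 : ℝ) (x₁ y : Plane) (g₁ : ℝ) (I : ℝ≥0∞) : ℝ≥0∞ :=
  ENNReal.ofReal Pt * ENNReal.ofReal g₁ * edist x₁ y ^ (-α) /
    (ENNReal.ofReal Pt * I + ENNReal.ofReal σ2)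

/-- The random objects of the network: the locations of the eavesdroppers, the gain of the link
from the typical transmitter to eavesdropper `j`, and, for every eavesdropper `j`, the interfering
transmitters that it observes together with the gains of the links from them. -/
structure Network (Ω ι κ : Type*) where
  eve : ι → Ω → Plane
  directGain : ι → Ω → ℝ
  interferer : ι → κ → Ω → Plane
  crossGain : ι → κ → Ω → ℝ

namespace Network

variable {Ω ι κ : Type*} (N : Network Ω ι κ)

/-- Distance from the typical transmitter (in `x₁`) to its nearest eavesdropper. -/
noncomputable def nearestEve (x₁ : Plane) (ω : Ω) : ℝ≥0∞ := ⨅ j, edist x₁ (N.eve j ω)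

/-- The event that no eavesdropper is in the guard zone of the typical transmitter. -/
def guardClear (rg : ℝ) (x₁ : Plane) : Set Ω := {ω | ENNReal.ofReal rg ≤ N.nearestEve x₁ ω}

/-- Interference that the transmitters observed by eavesdropper `j` cause at the location `y`. -/
noncomputable def interferenceAt (α rg : ℝ) (j : ι) (y : Plane) (ω : Ω) : ℝ≥0∞ :=
  interference α rg y (fun i => N.interferer j i ω) (fun i => N.crossGain j i ω)

/-- SINR at eavesdropper `j` of the signal of the typical transmitter. -/
noncomputable def eveSinr (α Pt σ2 rg : ℝ) (x₁ : Plane) (j : ι) (ω : Ω) : ℝ≥0∞ :=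
  sinr α Pt σ2 x₁ (N.eve j ω) (N.directGain j ω) (N.interferenceAt α rg j (N.eve j ω) ω)

variable [MeasurableSpace Ω] (P : Measure Ω)

/-- Probability that the typical transmitter is active. -/
noncomputable def activeProb (rg : ℝ) (x₁ : Plane) : ℝ := P.real (N.guardClear rg x₁)

/-- Secure communication probability: given that the typical transmitter is active, the
probability that the SINR at every eavesdropper is at most `βS`. -/
noncomputable def secureProb (α Pt σ2 βS rg : ℝ) (x₁ : Plane) : ℝ :=
  (P[|N.guardClear rg x₁]).real {ω | ∀ j, N.eveSinr α Pt σ2 rg x₁ j ω ≤ ENNReal.ofReal βS}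

/-- Everything about eavesdropper `j` apart from its location: gain of the direct link, observed
interferers, gains of the links from them. -/
def environment (j : ι) (ω : Ω) : ℝ × (κ → Plane) × (κ → ℝ) :=
  (N.directGain j ω, fun i => N.interferer j i ω, fun i => N.crossGain j i ω)

/-- The approximating stochastic model. The eavesdroppers form a homogeneous Poisson process of
density `lamS`. All gains are exponential with mean one. The active transmitters seen by an
eavesdropper are a homogeneous Poisson process whose density is `lamP` times the activity
probability (in place of a Poisson hole process). The environments of different eavesdroppers are
independent of each other and of the eavesdroppers' locations, and within one environment
the interferer locations and all the gains are independent. -/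
structure IsApproximateModel (lamS lamP rg : ℝ) (x₁ : Plane) : Prop where
  eve_ppp : IsHomogeneousPPP N.eve lamS P
  directGain_measurable : ∀ j, Measurable (N.directGain j)
  crossGain_measurable : ∀ j i, Measurable (N.crossGain j i)
  directGain_law : ∀ j, HasLaw (N.directGain j) (expMeasure 1) P
  interferer_ppp : ∀ j, IsHomogeneousPPP (N.interferer j) (lamP * N.activeProb P rg x₁) P
  crossGain_law : ∀ j i, HasLaw (N.crossGain j i) (expMeasure 1) P
  indep_eve_environment : IndepFun (fun ω j => N.eve j ω) (fun ω j => N.environment j ω) P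
  indep_environment : iIndepFun N.environment P
  indep_directGain : ∀ j, IndepFun (N.directGain j)
    (fun ω => ((fun i => N.interferer j i ω), (fun i => N.crossGain j i ω))) P
  indep_interferer : ∀ j, IndepFun (fun ω i => N.interferer j i ω)
    (fun ω i => N.crossGain j i ω) P
  indep_crossGain : ∀ j, iIndepFun (N.crossGain j) P

end Network

/-- Domain of integration `0 < z ≤ s * rg ^ (-α)`; the upper limit is infinite if `rg = 0`. -/
noncomputable def zRange (α rg s : ℝ) : Set ℝ :=
  if rg = 0 then Set.Ioi 0 else Set.Ioc 0 (s * rg ^ (-α))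

/-- The integrand in the exponent of the Laplace transform of the interference. -/
noncomputable def zIntegrand (α s z : ℝ) : ℝ := s ^ (2 / α) / (α * (1 + z) * z ^ (2 / α))

/-- The explicit Laplace transform, for active interferers of density `lam`. -/
noncomputable def laplaceI2 (α rg lam s : ℝ) : ℝ :=
  Real.exp (-(2 * π * lam * ∫ z in zRange α rg s, zIntegrand α s z))

/-- The integrand in the exponent of the secure communication probability. -/
noncomputable def secureIntegrand (α Pt σ2 βS rg lam r : ℝ) : ℝ :=
  Real.exp (-(σ2 * βS * r ^ α / Pt)) * laplaceI2 α rg lam (βS * r ^ α) * r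

/-! All three formulas are instances of one identity, the Laplace functional of an independently
marked Poisson process: E exp(-∑ φ(Xᵢ, mᵢ)) = exp(-∫ (1 - E exp(-φ(x, m))) dμ(x)), see
`IsPoissonProcess.lintegral_expNeg_tsum_mark`. It is proved for φ with values in [0, ∞]; functions
with values 0 and ∞ turn it into a formula for the probability that no point is bad.

Unmarked, with φ = ∞ on the guard disc, it gives the activity probability (`measure_guardClear`).
With the interferers as points and the exponential gains as marks it gives the transform of the
interference (`lintegral_expNeg_interference`): a gain contributes 1/(1 + s r^(-α)), and the
substitution z = s r^(-α) produces the z-integral. With the eavesdroppers as points and their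
environments as marks it gives the joint probability of an empty guard zone and secrecy
(`measure_guardClear_inter`).

An eavesdropper at distance r decodes when its exponential gain exceeds β r^α (I + σ²/P_t), which
has probability exp(-σ² β r^α/P_t) L(β r^α) (`measure_sinr_le`). The intensity of bad eavesdroppers
thus splits into the guard disc and the decoders outside it; conditioning cancels the factor of the
disc. -/

open Filter Topology

/-! ### Exponentials and Laplace transforms with values in [0, ∞] -/

/-- The function `x ↦ exp (-x)` on the extended nonnegative reals. -/
noncomputable def expNeg (x : ℝ≥0∞) : ℝ≥0∞ := (EReal.exp x)⁻¹

@[simp] lemma expNeg_zero : expNeg 0 = 1 := by simp [expNeg]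

@[simp] lemma expNeg_top : expNeg ∞ = 0 := by simp [expNeg]

lemma expNeg_add (x y : ℝ≥0∞) : expNeg (x + y) = expNeg x * expNeg y := by
  have h : ∀ z : ℝ≥0∞, EReal.exp z ≠ 0 := fun z => by simp
  rw [expNeg, EReal.coe_ennreal_add, EReal.exp_add, ENNReal.mul_inv (.inl (h x)) (.inr (h y))]
  rfl

lemma expNeg_sum {ι : Type*} (s : Finset ι) (f : ι → ℝ≥0∞) :
    expNeg (∑ i ∈ s, f i) = ∏ i ∈ s, expNeg (f i) := by
  induction s using Finset.cons_induction with
  | empty => simp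
  | cons i s hi ih => simp [expNeg_add, ih]

lemma continuous_expNeg : Continuous expNeg :=
  ENNReal.continuous_exp.comp continuous_coe_ennreal_ereal |>.inv

lemma measurable_expNeg : Measurable expNeg := continuous_expNeg.measurable

lemma antitone_expNeg : Antitone expNeg := fun _ _ h =>
  ENNReal.inv_le_inv.2 (EReal.exp_monotone (by exact_mod_cast h))

lemma expNeg_le_one (x : ℝ≥0∞) : expNeg x ≤ 1 := by
  simpa using antitone_expNeg (zero_le (a := x))

lemma expNeg_ne_top (x : ℝ≥0∞) : expNeg x ≠ ∞ :=
  ne_top_of_le_ne_top ENNReal.one_ne_top (expNeg_le_one x)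

lemma expNeg_of_ne_top {x : ℝ≥0∞} (hx : x ≠ ∞) :
    expNeg x = ENNReal.ofReal (Real.exp (-x.toReal)) := by
  lift x to ℝ≥0 using hx
  rw [expNeg, ENNReal.coe_toReal, Real.exp_neg, ENNReal.ofReal_inv_of_pos (Real.exp_pos _)]
  rfl

lemma expNeg_ofReal {x : ℝ} (hx : 0 ≤ x) :
    expNeg (ENNReal.ofReal x) = ENNReal.ofReal (Real.exp (-x)) := by
  rw [expNeg_of_ne_top ENNReal.ofReal_ne_top, ENNReal.toReal_ofReal hx]

lemma tendsto_prod_expNeg {ι : Type*} (f : ι → ℝ≥0∞) :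
    Tendsto (fun s : Finset ι => ∏ i ∈ s, expNeg (f i)) atTop (𝓝 (expNeg (∑' i, f i))) := by
  simp_rw [← expNeg_sum]
  exact (continuous_expNeg.tendsto _).comp ENNReal.summable.hasSum

/-- The inverse of `expNeg` on `[0, 1]`. -/
noncomputable def negLog (v : ℝ≥0∞) : ℝ≥0∞ := (ENNReal.log v⁻¹).toENNReal

lemma measurable_negLog : Measurable negLog :=
  (ENNReal.measurable_log.comp measurable_inv).ereal_toENNReal

/-- This lets a product of factors in [0, 1], possibly 0, be written as the exponential of a sum.
The bound matters because `toENNReal` truncates negative logarithms. -/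
lemma expNeg_negLog {v : ℝ≥0∞} (hv : v ≤ 1) : expNeg (negLog v) = v := by
  rw [expNeg, negLog, EReal.coe_toENNReal, ENNReal.exp_log, inv_inv]
  simpa using hv

lemma expNeg_mul_natCast (c : ℝ≥0∞) (n : ℕ) : expNeg (c * n) = expNeg c ^ n := by
  have := expNeg_sum (Finset.range n) (fun _ => c)
  simpa [mul_comm] using this

/-- The Poisson generating function at q = exp(-c). The case c = ∞ is included: with 0⁰ = 1 only n =
0 contributes. -/
lemma lintegral_expNeg_mul_poissonMeasure (r : ℝ≥0) (c : ℝ≥0∞) :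
    ∫⁻ n, expNeg (c * n) ∂(poissonMeasure r) = expNeg (r * (1 - expNeg c)) := by
  have hq : expNeg c = ENNReal.ofReal (expNeg c).toReal :=
    (ENNReal.ofReal_toReal (expNeg_ne_top c)).symm
  have hq1 : (expNeg c).toReal ≤ 1 := ENNReal.toReal_le_of_le_ofReal zero_le_one
    (by simpa using expNeg_le_one c)
  have hq0 : 0 ≤ (expNeg c).toReal := ENNReal.toReal_nonneg
  simp_rw [expNeg_mul_natCast]
  generalize (expNeg c).toReal = q at *
  rw [hq, lintegral_countable']
  have h1 : ∀ n : ℕ, ENNReal.ofReal q ^ n * (poissonMeasure r) {n} =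
      ENNReal.ofReal (Real.exp (-r) * ((r * q) ^ n / n.factorial)) := by
    intro n
    rw [poissonMeasure_singleton, ← ENNReal.ofReal_pow hq0, ← ENNReal.ofReal_mul (by positivity)]
    congr 1
    rw [mul_pow]
    ring
  have h2 : HasSum (fun n : ℕ => Real.exp (-r) * ((r * q) ^ n / n.factorial))
      (Real.exp (-r) * Real.exp (r * q)) := by
    have := (NormedSpace.expSeries_div_hasSum_exp (𝔸 := ℝ) (r * q)).mul_left (Real.exp (-r))
    rwa [← Real.exp_eq_exp_ℝ] at this
  simp_rw [h1]
  rw [← ENNReal.ofReal_tsum_of_nonneg (fun n => by positivity) h2.summable, h2.tsum_eq,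
    ← ENNReal.ofReal_one, ← ENNReal.ofReal_sub _ hq0, ← ENNReal.ofReal_coe_nnreal,
    ← ENNReal.ofReal_mul r.coe_nonneg,
    expNeg_ofReal (mul_nonneg r.coe_nonneg (sub_nonneg.2 hq1)), ← Real.exp_add]
  congr 2
  ring

lemma expMeasure_eq_withDensity (r : ℝ) :
    expMeasure r = volume.withDensity (exponentialPDF r) := rfl

lemma lintegral_expNeg_mul_expMeasure (c : ℝ≥0∞) :
    ∫⁻ g, expNeg (c * ENNReal.ofReal g) ∂(expMeasure 1) = (1 + c)⁻¹ := by
  have hm : Measurable (exponentialPDF 1) := (measurable_exponentialPDFReal 1).ennreal_ofReal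
  rw [expMeasure_eq_withDensity, lintegral_withDensity_eq_lintegral_mul _ hm
    (by exact measurable_expNeg.comp (ENNReal.measurable_ofReal.const_mul c))]
  by_cases hc : c = ∞
  · subst hc
    simp only [Pi.mul_apply, add_top, ENNReal.inv_top]
    refine lintegral_eq_zero_of_ae_eq_zero ?_
    -- The point 0 has to be removed, because ∞ * 0 = 0 makes the exponential equal to 1 there.
    filter_upwards [measure_eq_zero_iff_ae_notMem.1 (Real.volume_singleton (a := 0))] with x hx
    rcases lt_or_gt_of_ne (show x ≠ 0 from hx) with h | h
    · simp [exponentialPDF_of_neg h]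
    · simp [ENNReal.top_mul, h]
  · lift c to ℝ≥0 using hc
    have hc0 : (0 : ℝ) < 1 + c := by positivity
    have h : ∀ x, (exponentialPDF 1 * fun g => expNeg (c * ENNReal.ofReal g)) x =
        (1 + c : ℝ≥0∞)⁻¹ * exponentialPDF (1 + c) x := by
      intro x
      rcases lt_or_ge x 0 with hx | hx
      · simp [exponentialPDF_of_neg hx]
      · have e : (1 + c : ℝ≥0∞)⁻¹ = ENNReal.ofReal (1 + c)⁻¹ := by
          rw [ENNReal.ofReal_inv_of_pos hc0, ENNReal.ofReal_add zero_le_one c.coe_nonneg]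
          simp
        rw [Pi.mul_apply, exponentialPDF_of_nonneg hx, exponentialPDF_of_nonneg hx, e,
          ← ENNReal.ofReal_coe_nnreal, ← ENNReal.ofReal_mul c.coe_nonneg,
          expNeg_ofReal (by positivity), ← ENNReal.ofReal_mul (by positivity),
          ← ENNReal.ofReal_mul (by positivity), ← mul_assoc, inv_mul_cancel₀ hc0.ne', one_mul,
          one_mul, ← Real.exp_add]
        congr 2
        ring_nf
    simp_rw [h]
    have hm' : Measurable (exponentialPDF (1 + c)) :=
      (measurable_exponentialPDFReal _).ennreal_ofReal
    rw [lintegral_const_mul _ hm',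
      lintegral_exponentialPDF_eq_one hc0, mul_one]

lemma expMeasure_one_le (w : ℝ≥0∞) :
    expMeasure 1 {g | ENNReal.ofReal g ≤ w} = 1 - expNeg w := by
  have := isProbabilityMeasure_expMeasure zero_lt_one
  by_cases hw : w = ∞
  · simp [hw]
  · lift w to ℝ≥0 using hw
    have h : {g : ℝ | ENNReal.ofReal g ≤ w} = Set.Iic (w : ℝ) := by
      ext g
      rw [Set.mem_ofPred_eq, Set.mem_Iic, ← ENNReal.ofReal_coe_nnreal,
        ENNReal.ofReal_le_ofReal_iff w.coe_nonneg]
    rw [h, ← ofReal_cdf, cdf_expMeasure_eq zero_lt_one, if_pos w.coe_nonneg, one_mul,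
      ENNReal.ofReal_sub _ (Real.exp_nonneg _), ← ENNReal.ofReal_coe_nnreal,
      expNeg_ofReal w.coe_nonneg, ENNReal.ofReal_one]

/-! ### Counting variables of a point process -/

section PointCount

variable {Ω E ι : Type*}

lemma pointCount_eq_tsum (X : ι → Ω → E) (B : Set E) (ω : Ω) :
    (pointCount X B ω : ℝ≥0∞) = ∑' i, B.indicator (fun _ => 1) (X i ω) := by
  rw [pointCount, ← ENNReal.tsum_set_one, tsum_subtype {i | X i ω ∈ B} (fun _ => (1 : ℝ≥0∞))]
  rfl

variable [MeasurableSpace Ω]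

lemma measurable_pointCount_coe [MeasurableSpace E] [Countable ι] {X : ι → Ω → E}
    (hX : ∀ i, Measurable (X i)) {B : Set E} (hB : MeasurableSet B) :
    Measurable (fun ω => (pointCount X B ω : ℝ≥0∞)) := by
  simp_rw [pointCount_eq_tsum]
  exact Measurable.tsum fun i => (measurable_const.indicator hB).comp (hX i)

/-- An `ℕ∞`-valued random variable with the point probabilities of a law `ρ` on `ℕ` has law `ρ`. -/
lemma lintegral_comp_of_measure_eq_natCast {P : Measure Ω} [IsProbabilityMeasure P]
    {ρ : Measure ℕ} [IsProbabilityMeasure ρ] {N : Ω → ℕ∞} (hN : ∀ n : ℕ, MeasurableSet {ω | N ω = n})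
    (h : ∀ n : ℕ, P {ω | N ω = n} = ρ {n}) (f : ℕ∞ → ℝ≥0∞) :
    ∫⁻ ω, f (N ω) ∂P = ∫⁻ n : ℕ, f n ∂ρ := by
  have hd : Pairwise (Function.onFun Disjoint fun n : ℕ => {ω | N ω = n}) := by
    intro m n hmn
    refine Set.disjoint_left.2 fun ω h₁ h₂ => hmn ?_
    exact_mod_cast (show N ω = m from h₁).symm.trans h₂
  -- The point probabilities already sum to 1, so `N` is almost surely finite and the value of `f`
  -- at ⊤ is irrelevant.
  have hU : ∀ᵐ ω ∂P, ω ∈ ⋃ n : ℕ, {ω | N ω = n} := by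
    refine (mem_ae_iff_prob_eq_one (MeasurableSet.iUnion hN)).2 ?_
    rw [measure_iUnion hd hN]
    simp_rw [h]
    have : ∑' n, ρ {n} = ρ Set.univ := by
      simpa using (lintegral_countable' (μ := ρ) (fun _ => 1)).symm
    simpa using this
  have hae : ∀ᵐ ω ∂P, f (N ω) = ∑' n : ℕ, {ω | N ω = n}.indicator (fun _ => f n) ω := by
    filter_upwards [hU] with ω hω
    obtain ⟨n, hn⟩ := Set.mem_iUnion.1 hω
    have hn : N ω = n := hn
    rw [tsum_eq_single n]
    · rw [Set.indicator_of_mem (show ω ∈ {ω | N ω = n} from hn), hn]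
    · intro m hm
      refine Set.indicator_of_notMem (fun hm' : N ω = m => hm ?_) _
      exact_mod_cast hm'.symm.trans hn
  rw [lintegral_congr_ae hae,
    lintegral_tsum fun n => (measurable_const.indicator (hN n)).aemeasurable, lintegral_countable']
  refine tsum_congr fun n => ?_
  rw [lintegral_indicator_const (hN n), h]

end PointCount

/-! ### Laplace functional of a Poisson process, without and with marks -/

namespace IsPoissonProcess

variable {Ω E ι : Type*} [MeasurableSpace Ω] [MeasurableSpace E] [Countable ι]
  {P : Measure Ω} [IsProbabilityMeasure P] {X : ι → Ω → E} {μ : Measure E}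

lemma lintegral_expNeg_mul_pointCount (hX : IsPoissonProcess X μ P) {B : Set E}
    (hB : MeasurableSet B) (hμB : μ B ≠ ∞) (c : ℝ≥0∞) :
    ∫⁻ ω, expNeg (c * pointCount X B ω) ∂P = expNeg (μ B * (1 - expNeg c)) := by
  have h := lintegral_comp_of_measure_eq_natCast (P := P)
    (ρ := poissonMeasure (μ B).toNNReal) (N := pointCount X B) ?_
    (hX.poisson B hB hμB) (fun n => expNeg (c * (n : ℝ≥0∞)))
  · rw [h]
    simp_rw [ENat.toENNReal_coe]
    rw [lintegral_expNeg_mul_poissonMeasure, ENNReal.coe_toNNReal hμB]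
  · intro n
    have := measurable_pointCount_coe hX.measurable hB (measurableSet_singleton (n : ℝ≥0∞))
    convert this using 1
    ext ω
    simp only [Set.mem_ofPred_eq, Set.mem_preimage, Set.mem_singleton_iff]
    rw [← ENat.toENNReal_coe, ENat.toENNReal_inj]

lemma lintegral_expNeg_tsum_sum_indicator (hX : IsPoissonProcess X μ P) {n : ℕ}
    {B : Fin n → Set E} (hB : ∀ k, MeasurableSet (B k)) (hμB : ∀ k, μ (B k) ≠ ∞)
    (hd : Pairwise (fun k l => Disjoint (B k) (B l))) (c : Fin n → ℝ≥0∞) :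
    ∫⁻ ω, expNeg (∑' i, ∑ k, (B k).indicator (fun _ => c k) (X i ω)) ∂P =
      expNeg (∑ k, μ (B k) * (1 - expNeg (c k))) := by
  have h1 : ∀ ω, ∑' i, ∑ k, (B k).indicator (fun _ => c k) (X i ω) =
      ∑ k, c k * pointCount X (B k) ω := by
    intro ω
    rw [Summable.tsum_finsetSum fun _ _ => ENNReal.summable]
    refine Finset.sum_congr rfl fun k _ => ?_
    rw [pointCount_eq_tsum, ← ENNReal.tsum_mul_left]
    refine tsum_congr fun i => ?_
    by_cases h : X i ω ∈ B k <;> simp [h]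
  simp_rw [h1, expNeg_sum]
  have hind : iIndepFun (fun k ω => expNeg (c k * pointCount X (B k) ω)) P :=
    (hX.indep n B hB hμB hd).comp (fun k (m : ℕ∞) => expNeg (c k * m))
      fun k => measurable_from_top
  rw [lintegral_prod_eq_prod_lintegral_of_indepFun _ _ hind fun k =>
    measurable_expNeg.comp ((measurable_pointCount_coe hX.measurable (hB k)).const_mul _)]
  exact Finset.prod_congr rfl fun k _ => hX.lintegral_expNeg_mul_pointCount (hB k) (hμB k) _

lemma lintegral_expNeg_tsum_simpleFunc (hX : IsPoissonProcess X μ P) (g : SimpleFunc E ℝ≥0∞)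
    (hg : μ (Function.support g) ≠ ∞) :
    ∫⁻ ω, expNeg (∑' i, g (X i ω)) ∂P = expNeg (∫⁻ x, (1 - expNeg (g x)) ∂μ) := by
  classical
  -- The fibre over 0 may have infinite intensity, where nothing is assumed about counts. It can be
  -- dropped because the functions applied to `g` below vanish at 0.
  let r := g.range.erase 0
  let c : Fin r.card → ℝ≥0∞ := fun k => (r.equivFin.symm k : ℝ≥0∞)
  have hc : Function.Injective c := Subtype.val_injective.comp r.equivFin.symm.injective
  have hc0 : ∀ k, c k ≠ 0 := fun k => (Finset.mem_erase.1 (r.equivFin.symm k).2).1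
  let B : Fin r.card → Set E := fun k => g ⁻¹' {c k}
  have hB : ∀ k, MeasurableSet (B k) := fun k => g.measurableSet_fiber _
  have hψ : ∀ ψ : ℝ≥0∞ → ℝ≥0∞, ψ 0 = 0 → ∀ x,
      ψ (g x) = ∑ k, (B k).indicator (fun _ => ψ (c k)) x := by
    intro ψ h0 x
    by_cases hx : g x = 0
    · rw [hx, h0, Finset.sum_eq_zero]
      intro k _
      exact Set.indicator_of_notMem (fun h : g x = c k => hc0 k (h.symm.trans hx)) _
    · have hmem : g x ∈ r := Finset.mem_erase.2 ⟨hx, g.mem_range_self x⟩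
      have hck : c (r.equivFin ⟨g x, hmem⟩) = g x := by simp [c]
      rw [Finset.sum_eq_single (r.equivFin ⟨g x, hmem⟩)]
      · rw [hck, Set.indicator_of_mem]
        exact hck.symm
      · intro k _ hk
        exact Set.indicator_of_notMem (fun h : g x = c k => hk (hc (h.symm.trans hck.symm))) _
      · simp
  have h1 : ∀ x, g x = ∑ k, (B k).indicator (fun _ => c k) x := hψ id rfl
  have h2 := hψ (fun v => 1 - expNeg v) (by simp)
  have hμB : ∀ k, μ (B k) ≠ ∞ := fun k => by
    refine ne_top_of_le_ne_top hg (measure_mono fun x (hx : g x = c k) => ?_)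
    rw [Function.mem_support, hx]
    exact hc0 k
  have hd : Pairwise (fun k l => Disjoint (B k) (B l)) := fun k l hkl =>
    Set.disjoint_left.2 fun x (h : g x = c k) (h' : g x = c l) => hkl (hc (h.symm.trans h'))
  calc ∫⁻ ω, expNeg (∑' i, g (X i ω)) ∂P
      = ∫⁻ ω, expNeg (∑' i, ∑ k, (B k).indicator (fun _ => c k) (X i ω)) ∂P := by
        simp_rw [← h1]
    _ = expNeg (∑ k, μ (B k) * (1 - expNeg (c k))) :=
        hX.lintegral_expNeg_tsum_sum_indicator hB hμB hd c
    _ = expNeg (∫⁻ x, (1 - expNeg (g x)) ∂μ) := by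
        congr 1
        simp_rw [h2]
        rw [lintegral_finsetSum _ fun k _ => measurable_const.indicator (hB k)]
        refine Finset.sum_congr rfl fun k _ => ?_
        rw [lintegral_indicator_const (hB k), mul_comm]

/-- Laplace functional of a Poisson process. -/
theorem lintegral_expNeg_tsum [SigmaFinite μ] (hX : IsPoissonProcess X μ P) {f : E → ℝ≥0∞}
    (hf : Measurable f) :
    ∫⁻ ω, expNeg (∑' i, f (X i ω)) ∂P = expNeg (∫⁻ x, (1 - expNeg (f x)) ∂μ) := by
  -- Cutting off to the spanning sets makes the supports have finite intensity while keeping the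
  -- approximation monotone.
  let g : ℕ → SimpleFunc E ℝ≥0∞ := fun n => (SimpleFunc.eapprox f n).restrict (spanningSets μ n)
  have hgx : ∀ n x, g n x = (spanningSets μ n).indicator (SimpleFunc.eapprox f n) x := fun n x => by
    rw [SimpleFunc.restrict_apply _ (measurableSet_spanningSets μ n)]
  have hmono : ∀ x, Monotone fun n => g n x := by
    intro x m n hmn
    simp only [hgx]
    by_cases hx : x ∈ spanningSets μ m
    · rw [Set.indicator_of_mem hx, Set.indicator_of_mem (monotone_spanningSets μ hmn hx)]
      exact SimpleFunc.monotone_eapprox f hmn x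
    · rw [Set.indicator_of_notMem hx]
      exact zero_le
  have hlim : ∀ x, Tendsto (fun n => g n x) atTop (𝓝 (f x)) := by
    intro x
    refine (SimpleFunc.tendsto_eapprox hf x).congr' ?_
    filter_upwards [eventually_ge_atTop (spanningSetsIndex μ x)] with n hn
    rw [hgx, Set.indicator_of_mem]
    exact monotone_spanningSets μ hn (mem_spanningSetsIndex μ x)
  have hsup : ∀ x, ⨆ n, g n x = f x := fun x => iSup_eq_of_tendsto (hmono x) (hlim x)
  have hsupp : ∀ n, μ (Function.support (g n)) ≠ ∞ := fun n => by
    refine ne_top_of_le_ne_top (measure_spanningSets_lt_top μ n).ne (measure_mono fun x hx => ?_)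
    by_contra h
    exact hx (by rw [hgx, Set.indicator_of_notMem h])
  have hsum : ∀ ω, Tendsto (fun n => ∑' i, g n (X i ω)) atTop (𝓝 (∑' i, f (X i ω))) := by
    intro ω
    -- The sum over points is an integral against counting measure, so monotone convergence applies.
    let _ : MeasurableSpace ι := ⊤
    have := lintegral_tendsto_of_tendsto_of_monotone (μ := Measure.count)
      (f := fun n i => g n (X i ω)) (F := fun i => f (X i ω))
      (fun n => measurable_from_top.aemeasurable) (Eventually.of_forall fun i => hmono _)
      (Eventually.of_forall fun i => hlim _)
    simpa [lintegral_count] using this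
  have hL : Tendsto (fun n => ∫⁻ ω, expNeg (∑' i, g n (X i ω)) ∂P) atTop
      (𝓝 (∫⁻ ω, expNeg (∑' i, f (X i ω)) ∂P)) := by
    refine tendsto_lintegral_of_dominated_convergence (fun _ => 1) (fun n => ?_)
      (fun n => Eventually.of_forall fun ω => expNeg_le_one _) (by simp)
      (Eventually.of_forall fun ω => (continuous_expNeg.tendsto _).comp (hsum ω))
    exact measurable_expNeg.comp
      (Measurable.tsum fun i => (g n).measurable.comp (hX.measurable i))
  have hR : Tendsto (fun n => ∫⁻ x, (1 - expNeg (g n x)) ∂μ) atTop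
      (𝓝 (∫⁻ x, (1 - expNeg (f x)) ∂μ)) := by
    refine lintegral_tendsto_of_tendsto_of_monotone (fun n => ?_)
      (Eventually.of_forall fun x m n hmn => tsub_le_tsub_left (antitone_expNeg (hmono x hmn)) _)
      (Eventually.of_forall fun x => ?_)
    · exact (measurable_const.sub (measurable_expNeg.comp (g n).measurable)).aemeasurable
    · exact ENNReal.Tendsto.sub tendsto_const_nhds ((continuous_expNeg.tendsto _).comp (hlim x))
        (.inl ENNReal.one_ne_top)
  refine tendsto_nhds_unique hL (((continuous_expNeg.tendsto _).comp hR).congr fun n => ?_)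
  exact (hX.lintegral_expNeg_tsum_simpleFunc (g n) (hsupp n)).symm

end IsPoissonProcess

/-- For independent `m i`, the expectation of an infinite product `∏ exp (-f i (m i))` factorizes. -/
lemma lintegral_expNeg_tsum_of_iIndepFun {Ω ι M : Type*} [MeasurableSpace Ω] [MeasurableSpace M]
    [Countable ι] {P : Measure Ω} {m : ι → Ω → M}
    (hm : ∀ i, Measurable (m i)) (hind : iIndepFun m P) {f : ι → M → ℝ≥0∞}
    (hf : ∀ i, Measurable (f i)) {v : ι → ℝ≥0∞}
    (hv : ∀ i, ∫⁻ ω, expNeg (f i (m i ω)) ∂P = expNeg (v i)) :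
    ∫⁻ ω, expNeg (∑' i, f i (m i ω)) ∂P = expNeg (∑' i, v i) := by
  have := hind.isProbabilityMeasure
  have hL : Tendsto (fun s : Finset ι => ∫⁻ ω, ∏ i ∈ s, expNeg (f i (m i ω)) ∂P) atTop
      (𝓝 (∫⁻ ω, expNeg (∑' i, f i (m i ω)) ∂P)) := by
    refine tendsto_lintegral_filter_of_dominated_convergence (fun _ => 1)
      (Eventually.of_forall fun s => ?_)
      (Eventually.of_forall fun s => Eventually.of_forall fun ω => ?_) (by simp)
      (Eventually.of_forall fun ω => tendsto_prod_expNeg _)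
    · exact Finset.measurable_fun_prod s fun i _ => measurable_expNeg.comp ((hf i).comp (hm i))
    · exact Finset.prod_le_one' fun i _ => expNeg_le_one _
  refine tendsto_nhds_unique hL ((tendsto_prod_expNeg v).congr fun s => ?_)
  have hind' : iIndepFun (fun i ω => expNeg (f i (m i ω))) P :=
    hind.comp (fun i x => expNeg (f i x)) fun i => measurable_expNeg.comp (hf i)
  rw [lintegral_prod_eq_prod_lintegral_of_indepFun s _ hind' fun i =>
    measurable_expNeg.comp ((hf i).comp (hm i))]
  exact (Finset.prod_congr rfl fun i _ => hv i).symm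

/-- Laplace functional of an independently marked Poisson process. -/
theorem IsPoissonProcess.lintegral_expNeg_tsum_mark {Ω E ι M : Type*} [MeasurableSpace Ω]
    [MeasurableSpace E] [MeasurableSpace M] [Countable ι] {P : Measure Ω} [IsProbabilityMeasure P]
    {X : ι → Ω → E} {μ : Measure E} [SigmaFinite μ] (hX : IsPoissonProcess X μ P)
    {m : ι → Ω → M} (hm : ∀ i, Measurable (m i)) (hind : iIndepFun m P)
    (hXm : IndepFun (fun ω i => X i ω) (fun ω i => m i ω) P)
    {φ : E → M → ℝ≥0∞} (hφ : Measurable (Function.uncurry φ)) {v : E → ℝ≥0∞} (hvm : Measurable v)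
    (hv1 : ∀ x, v x ≤ 1) (hv : ∀ i x, ∫⁻ ω, expNeg (φ x (m i ω)) ∂P = v x) :
    ∫⁻ ω, expNeg (∑' i, φ (X i ω) (m i ω)) ∂P = expNeg (∫⁻ x, (1 - v x) ∂μ) := by
  have hXM : Measurable (fun ω i => X i ω) := measurable_pi_lambda _ hX.measurable
  have hmM : Measurable (fun ω i => m i ω) := measurable_pi_lambda _ hm
  have hF : Measurable (fun p : (ι → E) × (ι → M) => expNeg (∑' i, φ (p.1 i) (p.2 i))) := by
    refine measurable_expNeg.comp (Measurable.tsum fun i => ?_)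
    have hi : Measurable (fun p : (ι → E) × (ι → M) => (p.1 i, p.2 i)) := by fun_prop
    exact hφ.comp hi
  have hφx : ∀ x, Measurable (φ x) := fun x => hφ.comp measurable_prodMk_left
  calc ∫⁻ ω, expNeg (∑' i, φ (X i ω) (m i ω)) ∂P
      = ∫⁻ p, expNeg (∑' i, φ (p.1 i) (p.2 i)) ∂(P.map fun ω => ((fun i => X i ω), fun i => m i ω)) :=
        (lintegral_map hF (hXM.prodMk hmM)).symm
    -- Independence makes the joint law a product. For frozen points the marks integrate to ∏ v(xᵢ),
    -- which `negLog` rewrites as a Laplace functional of the points alone.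
    _ = ∫⁻ x, ∫⁻ y, expNeg (∑' i, φ (x i) (y i)) ∂(P.map fun ω i => m i ω)
          ∂(P.map fun ω i => X i ω) := by
        have := Measure.isProbabilityMeasure_map (μ := P) hmM.aemeasurable
        rw [hXm.map_prod_eq_prod_map_map hXM.aemeasurable hmM.aemeasurable,
          lintegral_prod _ hF.aemeasurable]
    _ = ∫⁻ x, expNeg (∑' i, negLog (v (x i))) ∂(P.map fun ω i => X i ω) := by
        refine lintegral_congr fun x => ?_
        refine (lintegral_map (hF.comp measurable_prodMk_left) hmM).trans ?_
        refine lintegral_expNeg_tsum_of_iIndepFun hm hind (fun i => hφx (x i)) fun i => ?_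
        rw [hv, expNeg_negLog (hv1 _)]
    _ = ∫⁻ ω, expNeg (∑' i, negLog (v (X i ω))) ∂P := by
        refine lintegral_map (measurable_expNeg.comp (Measurable.tsum fun i => ?_)) hXM
        exact measurable_negLog.comp (hvm.comp (measurable_pi_apply i))
    _ = expNeg (∫⁻ x, (1 - v x) ∂μ) := by
        rw [hX.lintegral_expNeg_tsum (f := fun x => negLog (v x)) (measurable_negLog.comp hvm)]
        simp_rw [expNeg_negLog (hv1 _)]

/-! ### Convergence and substitutions in the deterministic integrals -/

section Analysis

lemma zIntegrand_eq_mul (α s z : ℝ) : zIntegrand α s z = s ^ (2 / α) * zIntegrand α 1 z := by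
  simp only [zIntegrand, Real.one_rpow]
  ring

lemma zIntegrand_nonneg {α s z : ℝ} (hα : 2 < α) (hs : 0 ≤ s) (hz : 0 ≤ z) :
    0 ≤ zIntegrand α s z := by
  have : 0 < α := by linarith
  unfold zIntegrand
  positivity

lemma measurable_zIntegrand (α : ℝ) : Measurable (fun p : ℝ × ℝ => zIntegrand α p.1 p.2) := by
  unfold zIntegrand
  fun_prop

lemma zRange_subset (α rg s : ℝ) : zRange α rg s ⊆ Set.Ioi 0 := by
  unfold zRange
  split_ifs
  · exact subset_rfl
  · exact Set.Ioc_subset_Ioi_self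

lemma measurableSet_zRange (α rg s : ℝ) : MeasurableSet (zRange α rg s) := by
  unfold zRange
  split_ifs
  · exact measurableSet_Ioi
  · exact measurableSet_Ioc

/-- The integrand is dominated by a multiple of z^(-2/α) near 0, integrable since α > 2, and of
z^(-1-2/α) near infinity. -/
lemma integrableOn_zIntegrand_Ioi {α : ℝ} (hα : 2 < α) (s : ℝ) :
    IntegrableOn (zIntegrand α s) (Set.Ioi 0) := by
  have hα0 : 0 < α := by linarith
  have hm : ∀ t, Measurable (zIntegrand α t) := fun t =>
    (measurable_zIntegrand α).comp measurable_prodMk_left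
  have h1 : 2 / α < 1 := (div_lt_one hα0).2 hα
  have h0 : 0 < 2 / α := by positivity
  suffices h : IntegrableOn (zIntegrand α 1) (Set.Ioi 0) by
    refine (h.const_mul (s ^ (2 / α))).congr (Eventually.of_forall fun z => ?_)
    exact (zIntegrand_eq_mul α s z).symm
  rw [← Set.Ioc_union_Ioi_eq_Ioi zero_le_one]
  refine IntegrableOn.union ?_ ?_
  · have hi : IntegrableOn (fun z : ℝ => z ^ (-(2 / α))) (Set.Ioc 0 1) :=
      (intervalIntegrable_iff_integrableOn_Ioc_of_le zero_le_one).1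
        (intervalIntegral.intervalIntegrable_rpow' (by linarith))
    refine Integrable.mono' (hi.const_mul α⁻¹) (hm 1).aestronglyMeasurable ?_
    refine (ae_restrict_mem measurableSet_Ioc).mono fun z hz => ?_
    have hz0 : 0 < z := hz.1
    rw [Real.norm_of_nonneg (zIntegrand_nonneg hα zero_le_one hz0.le), zIntegrand, Real.one_rpow,
      Real.rpow_neg hz0.le, ← mul_inv, one_div]
    have : 0 < z ^ (2 / α) := by positivity
    refine inv_anti₀ (by positivity) ?_
    rw [mul_assoc]
    refine mul_le_mul_of_nonneg_left ?_ hα0.le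
    nlinarith
  · have hi : IntegrableOn (fun z : ℝ => z ^ (-(1 + 2 / α))) (Set.Ioi 1) :=
      integrableOn_Ioi_rpow_of_lt (by linarith) one_pos
    refine Integrable.mono' (hi.const_mul α⁻¹) (hm 1).aestronglyMeasurable ?_
    refine (ae_restrict_mem measurableSet_Ioi).mono fun z hz => ?_
    have hz0 : 0 < z := zero_lt_one.trans hz
    rw [Real.norm_of_nonneg (zIntegrand_nonneg hα zero_le_one hz0.le), zIntegrand, Real.one_rpow,
      Real.rpow_neg hz0.le, ← mul_inv, one_div, Real.rpow_add hz0, Real.rpow_one]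
    have : 0 < z ^ (2 / α) := by positivity
    refine inv_anti₀ (by positivity) ?_
    rw [mul_assoc]
    refine mul_le_mul_of_nonneg_left ?_ hα0.le
    nlinarith

lemma integrableOn_zIntegrand {α : ℝ} (hα : 2 < α) (rg s : ℝ) :
    IntegrableOn (zIntegrand α s) (zRange α rg s) :=
  (integrableOn_zIntegrand_Ioi hα s).mono_set (zRange_subset α rg s)

lemma integral_zIntegrand_nonneg {α : ℝ} (hα : 2 < α) (rg : ℝ) {s : ℝ} (hs : 0 ≤ s) :
    0 ≤ ∫ z in zRange α rg s, zIntegrand α s z :=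
  setIntegral_nonneg (measurableSet_zRange α rg s) fun _ hz =>
    zIntegrand_nonneg hα hs (zRange_subset α rg s hz).le

lemma integral_zIntegrand_le {α : ℝ} (hα : 2 < α) (rg : ℝ) {s : ℝ} (hs : 0 ≤ s) :
    ∫ z in zRange α rg s, zIntegrand α s z ≤
      s ^ (2 / α) * ∫ z in Set.Ioi 0, zIntegrand α 1 z := by
  rw [← integral_const_mul]
  simp_rw [← zIntegrand_eq_mul α s]
  refine setIntegral_mono_set (integrableOn_zIntegrand_Ioi hα s) ?_
    (zRange_subset α rg s).eventuallyLE
  exact (ae_restrict_mem measurableSet_Ioi).mono fun z hz => zIntegrand_nonneg hα hs (le_of_lt hz)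

lemma laplaceI2_le_one {α rg lam s : ℝ} (hα : 2 < α) (hlam : 0 ≤ lam) (hs : 0 ≤ s) :
    laplaceI2 α rg lam s ≤ 1 := by
  have := integral_zIntegrand_nonneg hα rg hs
  rw [laplaceI2, Real.exp_le_one_iff, neg_nonpos]
  positivity

lemma laplaceI2_zero {α : ℝ} (hα : 2 < α) (rg lam : ℝ) : laplaceI2 α rg lam 0 = 1 := by
  have h : 2 / α ≠ 0 := by
    have : 0 < α := by linarith
    positivity
  simp [laplaceI2, zIntegrand, Real.zero_rpow h]

/-- Continuity of the transform at 0 is what yields almost sure finiteness of the interference. The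
exponent is at most a constant times s^(2/α). -/
lemma tendsto_laplaceI2 {α rg lam : ℝ} (hα : 2 < α) :
    Tendsto (laplaceI2 α rg lam) (𝓝[>] 0) (𝓝 1) := by
  have h0 : 0 < 2 / α := by
    have : 0 < α := by linarith
    positivity
  have h1 : Tendsto (fun s : ℝ => s ^ (2 / α) * ∫ z in Set.Ioi 0, zIntegrand α 1 z) (𝓝[>] 0)
      (𝓝 0) := by
    have := ((Real.continuous_rpow_const h0.le).tendsto 0).mul_const
      (∫ z in Set.Ioi 0, zIntegrand α 1 z)
    rw [Real.zero_rpow h0.ne', zero_mul] at this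
    exact this.mono_left nhdsWithin_le_nhds
  have h2 : Tendsto (fun s : ℝ => ∫ z in zRange α rg s, zIntegrand α s z) (𝓝[>] 0) (𝓝 0) := by
    refine squeeze_zero' ?_ ?_ h1
    · filter_upwards [self_mem_nhdsWithin] with s hs
      exact integral_zIntegrand_nonneg hα rg (le_of_lt hs)
    · filter_upwards [self_mem_nhdsWithin] with s hs
      exact integral_zIntegrand_le hα rg (le_of_lt hs)
  have h3 := (Real.continuous_exp.tendsto _).comp (h2.const_mul (2 * π * lam)).neg
  rw [mul_zero, neg_zero, Real.exp_zero] at h3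
  exact h3

lemma measurable_laplaceI2 (α rg lam : ℝ) : Measurable (laplaceI2 α rg lam) := by
  have hS : MeasurableSet {p : ℝ × ℝ | p.2 ∈ zRange α rg p.1} := by
    unfold zRange
    split_ifs
    · exact measurable_snd measurableSet_Ioi
    · exact (measurable_snd measurableSet_Ioi).inter
        (measurableSet_le measurable_snd (measurable_fst.mul_const _))
  have h : (fun s => ∫ z in zRange α rg s, zIntegrand α s z) = fun s =>
      ∫ z, {p : ℝ × ℝ | p.2 ∈ zRange α rg p.1}.indicator
        (fun p => zIntegrand α p.1 p.2) (s, z) := by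
    ext s
    rw [← integral_indicator (measurableSet_zRange α rg s)]
    rfl
  have h' : Measurable (fun s => ∫ z in zRange α rg s, zIntegrand α s z) := by
    rw [h]
    exact (((measurable_zIntegrand α).indicator hS).stronglyMeasurable.integral_prod_right'
      (ν := volume)).measurable
  exact Real.measurable_exp.comp (h'.const_mul _).neg

/-- Power loss from a transmitter at distance `r ≥ rg`, in the exponent of the Laplace transform. -/
noncomputable def lossIntegrand (α rg s r : ℝ) : ℝ :=
  if rg ≤ r then 1 - (1 + s * r ^ (-α))⁻¹ else 0

/-- The pointwise form of the substitution z = s r^(-α): the right side carries the Jacobians of w =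
r^(-α) and z = s w, and r ≥ rg becomes the upper limit on z. -/
lemma mul_lossIntegrand {α rg s r : ℝ} (hα : 2 < α) (hrg : 0 ≤ rg) (hs : 0 < s) (hr : 0 < r) :
    r * lossIntegrand α rg s r =
      |(-α)| * r ^ (-α - 1) * (s * (zRange α rg s).indicator (zIntegrand α s) (s * r ^ (-α))) := by
  have hα0 : 0 < α := by linarith
  have hw : 0 < r ^ (-α) := by positivity
  have hmem : s * r ^ (-α) ∈ zRange α rg s ↔ rg ≤ r := by
    unfold zRange
    split_ifs with h0
    · simp only [Set.mem_Ioi, h0, hr.le, iff_true]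
      positivity
    · have hrg0 : 0 < rg := lt_of_le_of_ne hrg (Ne.symm h0)
      rw [Set.mem_Ioc, mul_le_mul_iff_right₀ hs,
        Real.rpow_le_rpow_iff_of_neg hr hrg0 (neg_neg_of_pos hα0)]
      exact and_iff_right (by positivity)
  by_cases h : rg ≤ r
  · rw [lossIntegrand, if_pos h, Set.indicator_of_mem (hmem.2 h), zIntegrand,
      Real.mul_rpow hs.le hw.le, ← Real.rpow_mul hr.le, abs_neg, abs_of_pos hα0,
      Real.rpow_sub_one hr.ne']
    have e : -α * (2 / α) = -2 := by field_simp
    have e2 : r ^ (-2 : ℝ) = (r ^ 2)⁻¹ := by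
      rw [Real.rpow_neg hr.le]
      norm_num
    have hs2 : s ^ (2 / α) ≠ 0 := by positivity
    rw [e, e2]
    generalize r ^ (-α) = w at *
    have : 1 + s * w ≠ 0 := by positivity
    field_simp
    ring
  · rw [lossIntegrand, if_neg h, Set.indicator_of_notMem (mt hmem.1 h)]
    simp

lemma integrableOn_mul_lossIntegrand {α rg s : ℝ} (hα : 2 < α) (hrg : 0 ≤ rg) (hs : 0 < s) :
    IntegrableOn (fun r => r * lossIntegrand α rg s r) (Set.Ioi 0) := by
  have hα0 : -α ≠ 0 := by linarith
  have hg : IntegrableOn ((zRange α rg s).indicator (zIntegrand α s)) (Set.Ioi 0) :=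
    ((integrable_indicator_iff (measurableSet_zRange α rg s)).2
      (integrableOn_zIntegrand hα rg s)).integrableOn
  have h0 : IntegrableOn (fun w => (zRange α rg s).indicator (zIntegrand α s) (s * w))
      (Set.Ioi 0) := (integrableOn_Ioi_comp_mul_left_iff _ 0 hs).2 (by simpa using hg)
  have h1 : IntegrableOn (fun w => s * (zRange α rg s).indicator (zIntegrand α s) (s * w))
      (Set.Ioi 0) := h0.const_mul s
  have h2 := (integrableOn_Ioi_comp_rpow_iff _ hα0).2 h1
  refine h2.congr_fun (fun r hr => ?_) measurableSet_Ioi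
  exact (mul_lossIntegrand hα hrg hs hr).symm

lemma integral_mul_lossIntegrand {α rg s : ℝ} (hα : 2 < α) (hrg : 0 ≤ rg) (hs : 0 < s) :
    ∫ r in Set.Ioi 0, r * lossIntegrand α rg s r = ∫ z in zRange α rg s, zIntegrand α s z := by
  have hα0 : -α ≠ 0 := by linarith
  rw [setIntegral_congr_fun measurableSet_Ioi fun r hr => mul_lossIntegrand hα hrg hs hr]
  have h1 := integral_comp_rpow_Ioi
    (fun w => s * (zRange α rg s).indicator (zIntegrand α s) (s * w)) hα0
  simp only [smul_eq_mul] at h1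
  rw [h1, integral_const_mul, integral_comp_mul_left_Ioi _ 0 hs, smul_eq_mul, mul_zero,
    ← mul_assoc, mul_inv_cancel₀ hs.ne', one_mul, setIntegral_indicator (measurableSet_zRange _ _ _),
    Set.inter_eq_self_of_subset_right (zRange_subset α rg s)]

/-- Polar coordinates around `y`. -/
lemma lintegral_ofReal_dist {F : ℝ → ℝ} (hF : ∀ r, 0 ≤ F r)
    (hi : IntegrableOn (fun r => r * F r) (Set.Ioi 0)) (y : Plane) :
    ∫⁻ x, ENNReal.ofReal (F (dist x y)) = ENNReal.ofReal (2 * π * ∫ r in Set.Ioi 0, r * F r) := by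
  have hd : Module.finrank ℝ Plane - 1 = 1 := by simp
  have hint : Integrable (fun x : Plane => F ‖x‖) := by
    rw [integrable_fun_norm_addHaar]
    simpa [hd] using hi
  have hb : (volume : Measure Plane).real (Metric.ball 0 1) = π := by
    rw [Measure.real, EuclideanSpace.volume_ball_fin_two]
    simp [Real.pi_pos.le]
  simp_rw [dist_eq_norm]
  rw [lintegral_sub_right_eq_self (fun x : Plane => ENNReal.ofReal (F ‖x‖)) y,
    ← ofReal_integral_eq_lintegral_ofReal hint (Eventually.of_forall fun x => hF _),
    integral_fun_norm_addHaar, hb, hd]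
  simp [mul_assoc]

/-- Noise gives decay exp(-b r^α); interference gives decay exp(-b r²). With neither, the integrand
would be r, which is not integrable. -/
lemma integrableOn_secureIntegrand {α Pt σ2 βS rg lam : ℝ} (hα : 2 < α) (hPt : 0 < Pt)
    (hσ2 : 0 ≤ σ2) (hβS : 0 < βS) (hrg : 0 ≤ rg) (hlam : 0 ≤ lam) (hpos : 0 < σ2 ∨ 0 < lam) :
    IntegrableOn (secureIntegrand α Pt σ2 βS rg lam) (Set.Ioi rg) := by
  have hα0 : 0 < α := by linarith
  have hm : Measurable (secureIntegrand α Pt σ2 βS rg lam) := by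
    have := measurable_laplaceI2 α rg lam
    unfold secureIntegrand
    fun_prop
  have hsub : Set.Ioi rg ⊆ Set.Ioi 0 := Set.Ioi_subset_Ioi hrg
  have hnn : ∀ r ∈ Set.Ioi rg, 0 ≤ secureIntegrand α Pt σ2 βS rg lam r := fun r hr => by
    have : 0 < r := hsub hr
    unfold secureIntegrand laplaceI2
    positivity
  rcases hpos with hσ | hl
  · have hb : 0 < σ2 * βS / Pt := by positivity
    have hi := (integrableOn_rpow_mul_exp_neg_mul_rpow (s := 1) (p := α) (by norm_num)
      (by linarith) hb).mono_set hsub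
    refine Integrable.mono' hi hm.aestronglyMeasurable ?_
    refine (ae_restrict_mem measurableSet_Ioi).mono fun r hr => ?_
    have hr0 : 0 < r := hsub hr
    rw [Real.norm_of_nonneg (hnn r hr), secureIntegrand, Real.rpow_one, mul_comm]
    refine mul_le_mul_of_nonneg_left ?_ hr0.le
    refine (mul_le_of_le_one_right (Real.exp_nonneg _)
      (laplaceI2_le_one hα hlam (by positivity))).trans_eq ?_
    congr 1
    ring
  -- For r > rg > 0 the upper limit βS (r/rg)^α is at least βS, and for rg = 0 it is infinite.
  -- Restricting to z ≤ βS therefore bounds the exponent below by a constant times (βS r^α)^(2/α),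
  -- that is, by a constant times r².
  · set c := ∫ z in Set.Ioc 0 βS, zIntegrand α 1 z with hc
    have hc0 : 0 < c := by
      rw [hc, setIntegral_pos_iff_support_of_nonneg_ae
        ((ae_restrict_mem measurableSet_Ioc).mono fun z hz =>
          zIntegrand_nonneg hα zero_le_one hz.1.le)
        ((integrableOn_zIntegrand_Ioi hα 1).mono_set Set.Ioc_subset_Ioi_self),
        Set.inter_eq_self_of_subset_right]
      · simpa using hβS
      · intro z hz
        have : 0 < z := hz.1
        rw [Function.mem_support, zIntegrand, Real.one_rpow]
        positivity
    have hb : 0 < 2 * π * lam * (βS ^ (2 / α) * c) := by positivity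
    have hi := (integrableOn_rpow_mul_exp_neg_mul_rpow (s := 1) (p := 2) (by norm_num)
      (by norm_num) hb).mono_set hsub
    refine Integrable.mono' hi hm.aestronglyMeasurable ?_
    refine (ae_restrict_mem measurableSet_Ioi).mono fun r hr => ?_
    have hr0 : 0 < r := hsub hr
    rw [Real.norm_of_nonneg (hnn r hr), secureIntegrand, Real.rpow_one, mul_comm]
    refine mul_le_mul_of_nonneg_left ?_ hr0.le
    have he : Real.exp (-(σ2 * βS * r ^ α / Pt)) ≤ 1 := by
      rw [Real.exp_le_one_iff, neg_nonpos]
      positivity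
    refine (mul_le_of_le_one_left (Real.exp_nonneg _) he).trans ?_
    rw [Real.exp_le_exp, neg_mul, neg_le_neg_iff, mul_assoc (2 * π * lam)]
    refine mul_le_mul_of_nonneg_left ?_ (by positivity)
    have hs : 0 ≤ βS * r ^ α := by positivity
    have hpow : (βS * r ^ α) ^ (2 / α) = βS ^ (2 / α) * r ^ (2 : ℝ) := by
      rw [Real.mul_rpow hβS.le (by positivity), ← Real.rpow_mul hr0.le]
      congr 2
      field_simp
    have hsubset : Set.Ioc 0 βS ⊆ zRange α rg (βS * r ^ α) := by
      intro z hz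
      unfold zRange
      split_ifs with h0
      · exact hz.1
      · have hrg0 : 0 < rg := lt_of_le_of_ne hrg (Ne.symm h0)
        refine ⟨hz.1, hz.2.trans ?_⟩
        rw [mul_assoc, Real.rpow_neg hrg, ← div_eq_mul_inv, ← Real.div_rpow hr0.le hrg]
        refine le_mul_of_one_le_right hβS.le (Real.one_le_rpow ?_ hα0.le)
        rw [one_le_div hrg0]
        exact le_of_lt hr
    calc βS ^ (2 / α) * c * r ^ (2 : ℝ)
        = ∫ z in Set.Ioc 0 βS, zIntegrand α (βS * r ^ α) z := by
          simp_rw [zIntegrand_eq_mul α (βS * r ^ α)]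
          rw [integral_const_mul, hpow, ← hc]
          ring
      _ ≤ _ := by
          refine setIntegral_mono_set (integrableOn_zIntegrand hα rg _) ?_ hsubset.eventuallyLE
          exact (ae_restrict_mem (measurableSet_zRange _ _ _)).mono fun z hz =>
            zIntegrand_nonneg hα hs (zRange_subset α rg _ hz).le

end Analysis

lemma expNeg_tsum_ite {ι : Type*} (p : ι → Prop) [DecidablePred p] [Decidable (∀ i, p i)] :
    expNeg (∑' i, if p i then 0 else ∞) = if ∀ i, p i then 1 else 0 := by
  split_ifs with h
  · simp [h]
  · push Not at h
    obtain ⟨i, hi⟩ := h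
    rw [ENNReal.tsum_eq_top_of_eq_top ⟨i, by simp [hi]⟩, expNeg_top]

lemma lintegral_ite_one_zero {Ω : Type*} [MeasurableSpace Ω] (P : Measure Ω) {p : Ω → Prop}
    [DecidablePred p] (hp : MeasurableSet {ω | p ω}) :
    ∫⁻ ω, (if p ω then 1 else 0) ∂P = P {ω | p ω} := by
  rw [← lintegral_indicator_one hp]
  refine lintegral_congr fun ω => ?_
  by_cases h : p ω <;> simp [h]

/-- Finiteness is essential: `toReal` sends ∞ to 0, so on I = ∞ the real integrand would be 1
instead of 0 for s > 0. -/
lemma integral_exp_neg_mul_toReal {Ω : Type*} [MeasurableSpace Ω] {P : Measure Ω}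
    {I : Ω → ℝ≥0∞} (hI : Measurable I) (hfin : ∀ᵐ ω ∂P, I ω < ∞)
    {s : ℝ} (hs : 0 ≤ s) :
    ∫ ω, Real.exp (-(s * (I ω).toReal)) ∂P =
      (∫⁻ ω, expNeg (ENNReal.ofReal s * I ω) ∂P).toReal := by
  have hm : Measurable (fun ω => Real.exp (-(s * (I ω).toReal))) :=
    Real.measurable_exp.comp (hI.ennreal_toReal.const_mul s).neg
  rw [integral_eq_lintegral_of_nonneg_ae (Eventually.of_forall fun ω => (Real.exp_nonneg _))
    hm.aestronglyMeasurable]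
  congr 1
  refine lintegral_congr_ae ?_
  filter_upwards [hfin] with ω hω
  rw [expNeg_of_ne_top (ENNReal.mul_ne_top ENNReal.ofReal_ne_top hω.ne), ENNReal.toReal_mul,
    ENNReal.toReal_ofReal hs]

instance (lam : ℝ) : SigmaFinite (ENNReal.ofReal lam • (volume : Measure Plane)) :=
  inferInstanceAs (SigmaFinite (lam.toNNReal • (volume : Measure Plane)))

/-! ### Law of the interference and exponential tails -/

section Interference

variable {Ω κ : Type*} [MeasurableSpace Ω]

lemma measurable_interference [Countable κ] (α rg : ℝ) {y : Ω → Plane} {X : Ω → κ → Plane}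
    {g : Ω → κ → ℝ} (hy : Measurable y) (hX : Measurable X) (hg : Measurable g) :
    Measurable (fun ω => interference α rg (y ω) (X ω) (g ω)) := by
  refine Measurable.tsum fun i => ?_
  have he : Measurable (fun ω => edist (X ω i) (y ω)) := by fun_prop
  have hg : Measurable (fun ω => ENNReal.ofReal (g ω i)) := by fun_prop
  classical
  simp only [Set.indicator_apply, Set.mem_ofPred_eq]
  exact Measurable.ite (measurableSet_le measurable_const he) (hg.mul (he.pow_const _))
    measurable_const

/-- Path loss from `x` to a receiver at `y`, zero if `x` is in the guard zone of `y`. -/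
noncomputable def pathLoss (α rg : ℝ) (y x : Plane) : ℝ≥0∞ :=
  {x | ENNReal.ofReal rg ≤ edist x y}.indicator (fun x => edist x y ^ (-α)) x

lemma measurable_pathLoss (α rg : ℝ) (y : Plane) : Measurable (pathLoss α rg y) :=
  Measurable.indicator (by fun_prop) (measurableSet_le measurable_const (by fun_prop))

lemma mul_interference (α rg : ℝ) (y : Plane) (X : κ → Plane) (g : κ → ℝ) (s : ℝ≥0∞) :
    s * interference α rg y X g = ∑' i, s * pathLoss α rg y (X i) * ENNReal.ofReal (g i) := by
  rw [interference, ← ENNReal.tsum_mul_left]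
  refine tsum_congr fun i => ?_
  by_cases h : ENNReal.ofReal rg ≤ edist (X i) y
  · simp only [pathLoss, Set.indicator_apply, Set.mem_ofPred_eq, h, if_true]
    ring
  · simp [pathLoss, h]

/-- At x = y the two conventions for a negative power of 0 differ (∞ against 0), so the identity
fails there when rg = 0; the point is null in the integral. -/
lemma one_sub_inv_pathLoss {α rg s : ℝ} (hs : 0 < s) {x y : Plane} (hxy : x ≠ y) :
    1 - (1 + ENNReal.ofReal s * pathLoss α rg y x)⁻¹ =
      ENNReal.ofReal (lossIntegrand α rg s (dist x y)) := by
  have hd : 0 < dist x y := dist_pos.2 hxy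
  have hmem : ENNReal.ofReal rg ≤ edist x y ↔ rg ≤ dist x y := by
    rw [edist_dist, ENNReal.ofReal_le_ofReal_iff hd.le]
  by_cases h : rg ≤ dist x y
  · have hw : 0 < 1 + s * dist x y ^ (-α) := by positivity
    simp only [pathLoss, Set.indicator_apply, Set.mem_ofPred_eq, hmem, lossIntegrand, if_pos h]
    rw [edist_dist, ENNReal.ofReal_rpow_of_pos hd, ← ENNReal.ofReal_mul hs.le, ← ENNReal.ofReal_one,
      ← ENNReal.ofReal_add zero_le_one (by positivity), ← ENNReal.ofReal_inv_of_pos hw,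
      ← ENNReal.ofReal_sub _ (by positivity)]
  · simp [pathLoss, hmem, lossIntegrand, h]

lemma lossIntegrand_nonneg {α rg s : ℝ} (hrg : 0 ≤ rg) (hs : 0 ≤ s) (r : ℝ) :
    0 ≤ lossIntegrand α rg s r := by
  unfold lossIntegrand
  split_ifs with h
  · have hr : 0 ≤ r := hrg.trans h
    rw [sub_nonneg]
    exact inv_le_one_of_one_le₀ (le_add_of_nonneg_right (by positivity))
  · exact le_rfl

lemma lintegral_one_sub_inv_pathLoss {α rg s : ℝ} (hα : 2 < α) (hrg : 0 ≤ rg) (hs : 0 < s)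
    (y : Plane) :
    ∫⁻ x, (1 - (1 + ENNReal.ofReal s * pathLoss α rg y x)⁻¹) =
      ENNReal.ofReal (2 * π * ∫ z in zRange α rg s, zIntegrand α s z) := by
  rw [← integral_mul_lossIntegrand hα hrg hs, ← lintegral_ofReal_dist
    (lossIntegrand_nonneg hrg hs.le) (integrableOn_mul_lossIntegrand hα hrg hs) y]
  refine lintegral_congr_ae ?_
  filter_upwards [measure_eq_zero_iff_ae_notMem.1 (measure_singleton (μ := volume) y)] with x hx
  exact one_sub_inv_pathLoss hs hx

variable [Countable κ] {P : Measure Ω} [IsProbabilityMeasure P] {X : κ → Ω → Plane} {g : κ → Ω → ℝ}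
  {α rg lam : ℝ}

lemma lintegral_expNeg_interference (hα : 2 < α) (hrg : 0 ≤ rg) (hlam : 0 ≤ lam)
    (hX : IsHomogeneousPPP X lam P) (hgm : ∀ i, Measurable (g i))
    (hg : ∀ i, HasLaw (g i) (expMeasure 1) P) (hind : iIndepFun g P)
    (hXg : IndepFun (fun ω i => X i ω) (fun ω i => g i ω) P) (y : Plane) {s : ℝ} (hs : 0 ≤ s) :
    ∫⁻ ω, expNeg (ENNReal.ofReal s * interference α rg y (fun i => X i ω) (fun i => g i ω)) ∂P =
      ENNReal.ofReal (laplaceI2 α rg lam s) := by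
  -- The substitution z = s r^(-α) needs s > 0, so s = 0 is treated apart.
  rcases hs.eq_or_lt with rfl | hs
  · simp [laplaceI2_zero hα]
  simp_rw [mul_interference]
  have hp := measurable_pathLoss α rg y
  have hφ : Measurable (Function.uncurry fun (x : Plane) (t : ℝ) =>
      ENNReal.ofReal s * pathLoss α rg y x * ENNReal.ofReal t) := by
    unfold Function.uncurry
    fun_prop
  have hX' : IsPoissonProcess X (ENNReal.ofReal lam • (volume : Measure Plane)) P := hX
  rw [hX'.lintegral_expNeg_tsum_mark hgm hind hXg hφ
    (v := fun x => (1 + ENNReal.ofReal s * pathLoss α rg y x)⁻¹) (by fun_prop)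
    (fun x => ENNReal.inv_le_one.2 le_self_add)]
  · rw [lintegral_smul_measure, lintegral_one_sub_inv_pathLoss hα hrg hs, smul_eq_mul,
      ← ENNReal.ofReal_mul hlam, laplaceI2, expNeg_ofReal]
    · congr 3
      ring
    · have := integral_zIntegrand_nonneg hα rg hs.le
      positivity
  · intro i x
    rw [← lintegral_expNeg_mul_expMeasure, ← (hg i).map_eq, lintegral_map _ (hgm i)]
    exact measurable_expNeg.comp (ENNReal.measurable_ofReal.const_mul _)

/-- For s > 0 the variable exp(-sI) vanishes where I = ∞, so E exp(-sI) ≤ P(I < ∞); now let s tend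
to 0. -/
lemma ae_lt_top_of_tendsto_lintegral_expNeg {I : Ω → ℝ≥0∞} (hI : Measurable I) {L : ℝ → ℝ}
    (hL : ∀ s, 0 < s → ∫⁻ ω, expNeg (ENNReal.ofReal s * I ω) ∂P = ENNReal.ofReal (L s))
    (h1 : Tendsto L (𝓝[>] 0) (𝓝 1)) : ∀ᵐ ω ∂P, I ω < ∞ := by
  have hS : MeasurableSet {ω | I ω < ∞} := measurableSet_lt hI measurable_const
  have hle : ∀ s, 0 < s → ENNReal.ofReal (L s) ≤ P {ω | I ω < ∞} := by
    intro s hs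
    rw [← hL s hs, ← lintegral_indicator_one hS]
    refine lintegral_mono fun ω => ?_
    by_cases h : I ω < ∞
    · simpa [h] using expNeg_le_one _
    · rw [not_lt_top_iff.1 h, ENNReal.mul_top (by simpa using hs), expNeg_top]
      exact zero_le
  refine (mem_ae_iff_prob_eq_one hS).2 (le_antisymm prob_le_one ?_)
  have h2 := (ENNReal.continuous_ofReal.tendsto 1).comp h1
  rw [ENNReal.ofReal_one] at h2
  refine le_of_tendsto h2 ?_
  filter_upwards [self_mem_nhdsWithin] with s hs using hle s hs

/-- Given W, an exponential gain exceeds W with probability exp(-W); Fubini averages this over W. -/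
lemma measure_exponential_le_of_indepFun {G : Ω → ℝ} {W : Ω → ℝ≥0∞} (hG : Measurable G)
    (hW : Measurable W) (hlaw : HasLaw G (expMeasure 1) P) (hind : IndepFun G W P) :
    P {ω | ENNReal.ofReal (G ω) ≤ W ω} = 1 - ∫⁻ ω, expNeg (W ω) ∂P := by
  have hS : MeasurableSet {p : ℝ≥0∞ × ℝ | ENNReal.ofReal p.2 ≤ p.1} :=
    measurableSet_le (by fun_prop) (by fun_prop)
  have := isProbabilityMeasure_expMeasure zero_lt_one
  calc P {ω | ENNReal.ofReal (G ω) ≤ W ω}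
      = P.map (fun ω => (W ω, G ω)) {p | ENNReal.ofReal p.2 ≤ p.1} :=
        (Measure.map_apply (hW.prodMk hG) hS).symm
    _ = ∫⁻ ω, (1 - expNeg (W ω)) ∂P := by
        rw [hind.symm.map_prod_eq_prod_map_map hW.aemeasurable hG.aemeasurable, hlaw.map_eq,
          Measure.prod_apply hS, lintegral_map (measurable_measure_prodMk_left hS) hW]
        exact lintegral_congr fun ω => expMeasure_one_le (W ω)
    _ = 1 - ∫⁻ ω, expNeg (W ω) ∂P := by
        have hm : Measurable (fun ω => expNeg (W ω)) := measurable_expNeg.comp hW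
        rw [lintegral_sub hm _ (Eventually.of_forall fun ω => expNeg_le_one _)]
        · simp
        · refine ne_top_of_le_ne_top ENNReal.one_ne_top ?_
          calc ∫⁻ ω, expNeg (W ω) ∂P ≤ ∫⁻ _, 1 ∂P := lintegral_mono fun ω => expNeg_le_one _
            _ = 1 := by simp

end Interference

/-! ### Decoding probability of a single eavesdropper -/

section Sinr

lemma sinr_le_iff {α Pt σ2 βS : ℝ} (hPt : 0 < Pt) (hβS : 0 < βS) {x₁ y : Plane}
    (hxy : x₁ ≠ y) (g : ℝ) (I : ℝ≥0∞) :
    sinr α Pt σ2 x₁ y g I ≤ ENNReal.ofReal βS ↔ ENNReal.ofReal g ≤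
      ENNReal.ofReal (βS * dist x₁ y ^ α) * I + ENNReal.ofReal (σ2 * βS * dist x₁ y ^ α / Pt) := by
  have hd : 0 < dist x₁ y := dist_pos.2 hxy
  have hb : ENNReal.ofReal βS ≠ 0 := by simpa using hβS
  have hc : 0 < Pt * dist x₁ y ^ (-α) := by positivity
  have hpow : dist x₁ y ^ (-α) * dist x₁ y ^ α = 1 := by
    rw [← Real.rpow_add hd]
    simp
  -- Since βS is neither 0 nor ∞, clearing the denominator is valid even when the denominator is 0
  -- or ∞.
  rw [sinr, ENNReal.div_le_iff_le_mul (.inr ENNReal.ofReal_ne_top) (.inr hb),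
    edist_dist, ENNReal.ofReal_rpow_of_pos hd]
  have e1 : ENNReal.ofReal Pt * ENNReal.ofReal g * ENNReal.ofReal (dist x₁ y ^ (-α)) =
      ENNReal.ofReal (Pt * dist x₁ y ^ (-α)) * ENNReal.ofReal g := by
    rw [ENNReal.ofReal_mul hPt.le]
    ring
  have e2 : ENNReal.ofReal (Pt * dist x₁ y ^ (-α)) * (ENNReal.ofReal (βS * dist x₁ y ^ α) * I +
      ENNReal.ofReal (σ2 * βS * dist x₁ y ^ α / Pt)) =
      ENNReal.ofReal βS * (ENNReal.ofReal Pt * I + ENNReal.ofReal σ2) := by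
    rw [mul_add, mul_add, ← mul_assoc, ← mul_assoc, ← ENNReal.ofReal_mul hc.le,
      ← ENNReal.ofReal_mul hc.le, ← ENNReal.ofReal_mul hβS.le, ← ENNReal.ofReal_mul hβS.le]
    have a1 : Pt * dist x₁ y ^ (-α) * (βS * dist x₁ y ^ α) = βS * Pt := by
      linear_combination Pt * βS * hpow
    have a2 : Pt * dist x₁ y ^ (-α) * (σ2 * βS * dist x₁ y ^ α / Pt) = βS * σ2 := by
      rw [mul_div_assoc', div_eq_iff hPt.ne']
      linear_combination Pt * σ2 * βS * hpow
    rw [a1, a2]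
  rw [e1, ← e2, ENNReal.mul_le_mul_iff_right (by simpa using hc) ENNReal.ofReal_ne_top]

lemma measurable_sinr {Ω : Type*} [MeasurableSpace Ω] {y : Ω → Plane} {g : Ω → ℝ}
    {I : Ω → ℝ≥0∞} (hy : Measurable y) (hg : Measurable g) (hI : Measurable I)
    (α Pt σ2 : ℝ) (x₁ : Plane) : Measurable (fun ω => sinr α Pt σ2 x₁ (y ω) (g ω) (I ω)) := by
  have h1 : Measurable (fun ω => ENNReal.ofReal Pt * ENNReal.ofReal (g ω)) :=
    (ENNReal.measurable_ofReal.comp hg).const_mul _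
  have h2 : Measurable (fun ω => edist x₁ (y ω) ^ (-α)) :=
    (measurable_const.edist hy).pow_const _
  have h3 : Measurable (fun ω => ENNReal.ofReal Pt * I ω + ENNReal.ofReal σ2) :=
    (hI.const_mul _).add_const _
  exact (h1.mul h2).div h3

end Sinr

section Decode

variable {κ : Type*} {α Pt σ2 βS rg : ℝ} {x₁ : Plane}

/-- An eavesdropper at `y` with environment `m` is outside the guard zone of the transmitter in `x₁`
and cannot decode its signal. -/
def IsHarmless (α Pt σ2 βS rg : ℝ) (x₁ y : Plane) (m : ℝ × (κ → Plane) × (κ → ℝ)) : Prop :=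
  ENNReal.ofReal rg ≤ edist x₁ y ∧
    sinr α Pt σ2 x₁ y m.1 (interference α rg y m.2.1 m.2.2) ≤ ENNReal.ofReal βS

lemma measurableSet_isHarmless [Countable κ] :
    MeasurableSet {q : Plane × ℝ × (κ → Plane) × (κ → ℝ) |
      IsHarmless α Pt σ2 βS rg x₁ q.1 q.2} := by
  have hs := measurable_sinr (Ω := Plane × ℝ × (κ → Plane) × (κ → ℝ)) measurable_fst
    measurable_snd.fst (measurable_interference α rg measurable_fst measurable_snd.snd.fst
      measurable_snd.snd.snd) α Pt σ2 x₁
  exact (measurableSet_le measurable_const (measurable_const.edist measurable_fst)).inter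
    (measurableSet_le hs measurable_const)

/-- Probability that an eavesdropper at distance `r` decodes the signal. -/
noncomputable def decodeProb (α Pt σ2 βS rg lam r : ℝ) : ℝ :=
  Real.exp (-(σ2 * βS * r ^ α / Pt)) * laplaceI2 α rg lam (βS * r ^ α)

lemma decodeProb_nonneg (α Pt σ2 βS rg lam r : ℝ) : 0 ≤ decodeProb α Pt σ2 βS rg lam r :=
  mul_nonneg (Real.exp_nonneg _) (Real.exp_nonneg _)

lemma decodeProb_le_one {lam r : ℝ} (hα : 2 < α) (hPt : 0 < Pt) (hσ2 : 0 ≤ σ2) (hβS : 0 < βS)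
    (hlam : 0 ≤ lam) (hr : 0 ≤ r) : decodeProb α Pt σ2 βS rg lam r ≤ 1 := by
  refine mul_le_one₀ ?_ (Real.exp_nonneg _) (laplaceI2_le_one hα hlam (by positivity))
  rw [Real.exp_le_one_iff, neg_nonpos]
  positivity

lemma measurable_decodeProb (α Pt σ2 βS rg lam : ℝ) :
    Measurable (decodeProb α Pt σ2 βS rg lam) := by
  have := measurable_laplaceI2 α rg lam
  unfold decodeProb
  fun_prop

/-- Probability that an eavesdropper at distance `r` is outside the guard zone and cannot decode
the signal. -/
noncomputable def harmlessProb (α Pt σ2 βS rg lam r : ℝ) : ℝ≥0∞ :=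
  if rg ≤ r then 1 - ENNReal.ofReal (decodeProb α Pt σ2 βS rg lam r) else 0

variable {Ω : Type*} [MeasurableSpace Ω] {P : Measure Ω} [IsProbabilityMeasure P]
  {X : κ → Ω → Plane} {g : κ → Ω → ℝ} {G : Ω → ℝ} {lam : ℝ}

lemma measure_sinr_le (hα : 2 < α) (hPt : 0 < Pt) (hσ2 : 0 ≤ σ2) (hβS : 0 < βS)
    (hGm : Measurable G) (hG : HasLaw G (expMeasure 1) P) {I : Ω → ℝ≥0∞} (hI : Measurable I)
    (hGI : IndepFun G I P)
    (hL : ∀ s, 0 ≤ s →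
      ∫⁻ ω, expNeg (ENNReal.ofReal s * I ω) ∂P = ENNReal.ofReal (laplaceI2 α rg lam s))
    (y : Plane) :
    P {ω | sinr α Pt σ2 x₁ y (G ω) (I ω) ≤ ENNReal.ofReal βS} =
      1 - ENNReal.ofReal (decodeProb α Pt σ2 βS rg lam (dist x₁ y)) := by
  have hα0 : 0 < α := by linarith
  by_cases hxy : x₁ = y
  -- An eavesdropper at the transmitter has infinite SINR almost surely, matching decoding
  -- probability 1. This needs G > 0 and I < ∞, because ∞ * 0 and ∞ / ∞ are both 0.
  · subst hxy
    have hfin := ae_lt_top_of_tendsto_lintegral_expNeg hI (fun s hs => hL s hs.le)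
      (tendsto_laplaceI2 hα)
    have hpos : ∀ᵐ ω ∂P, 0 < G ω := by
      have h0 : P {ω | ENNReal.ofReal (G ω) ≤ 0} = 0 := by
        have h := measure_exponential_le_of_indepFun hGm (W := fun _ => 0) measurable_const hG
          (indepFun_const_right _ _)
        simpa using h
      filter_upwards [measure_eq_zero_iff_ae_notMem.1 h0] with ω hω
      simpa using hω
    have hR : decodeProb α Pt σ2 βS rg lam (dist x₁ x₁) = 1 := by
      simp [decodeProb, Real.zero_rpow hα0.ne', laplaceI2_zero hα]
    rw [hR, ENNReal.ofReal_one, tsub_self, measure_eq_zero_iff_ae_notMem]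
    filter_upwards [hfin, hpos] with ω hω hGω
    have hden : ENNReal.ofReal Pt * I ω + ENNReal.ofReal σ2 ≠ ∞ :=
      ENNReal.add_ne_top.2 ⟨ENNReal.mul_ne_top ENNReal.ofReal_ne_top hω.ne, ENNReal.ofReal_ne_top⟩
    have hnum : ENNReal.ofReal Pt * ENNReal.ofReal (G ω) ≠ 0 := by simp [hPt, hGω]
    simp only [sinr, edist_self, ENNReal.zero_rpow_of_neg (neg_neg_of_pos hα0)]
    rw [ENNReal.mul_top hnum, ENNReal.top_div_of_ne_top hden]
    simp
  · simp_rw [sinr_le_iff hPt hβS hxy]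
    have hs : 0 ≤ βS * dist x₁ y ^ α := by positivity
    have hm : Measurable (fun t : ℝ≥0∞ => ENNReal.ofReal (βS * dist x₁ y ^ α) * t +
        ENNReal.ofReal (σ2 * βS * dist x₁ y ^ α / Pt)) := by fun_prop
    have hW : Measurable (fun ω => ENNReal.ofReal (βS * dist x₁ y ^ α) * I ω +
        ENNReal.ofReal (σ2 * βS * dist x₁ y ^ α / Pt)) := hm.comp hI
    have hind : IndepFun G (fun ω => ENNReal.ofReal (βS * dist x₁ y ^ α) * I ω +
        ENNReal.ofReal (σ2 * βS * dist x₁ y ^ α / Pt)) P := hGI.comp measurable_id hm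
    rw [measure_exponential_le_of_indepFun hGm hW hG hind]
    simp_rw [expNeg_add]
    have hm' : Measurable (fun ω => expNeg (ENNReal.ofReal (βS * dist x₁ y ^ α) * I ω)) :=
      measurable_expNeg.comp (hI.const_mul _)
    rw [lintegral_mul_const _ hm', hL _ hs,
      expNeg_ofReal (by positivity), mul_comm, ← ENNReal.ofReal_mul (Real.exp_nonneg _), decodeProb]

lemma measure_isHarmless [Countable κ] (hα : 2 < α) (hPt : 0 < Pt) (hσ2 : 0 ≤ σ2)
    (hβS : 0 < βS) (hrg : 0 ≤ rg) (hlam : 0 ≤ lam) (hX : IsHomogeneousPPP X lam P) (hgm : ∀ i, Measurable (g i))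
    (hg : ∀ i, HasLaw (g i) (expMeasure 1) P) (hind : iIndepFun g P)
    (hXg : IndepFun (fun ω i => X i ω) (fun ω i => g i ω) P)
    (hGm : Measurable G) (hG : HasLaw G (expMeasure 1) P)
    (hGXg : IndepFun G (fun ω => ((fun i => X i ω), (fun i => g i ω))) P) (y : Plane) :
    P {ω | IsHarmless α Pt σ2 βS rg x₁ y (G ω, (fun i => X i ω), (fun i => g i ω))} =
      harmlessProb α Pt σ2 βS rg lam (dist y x₁) := by
  have hmem : ENNReal.ofReal rg ≤ edist x₁ y ↔ rg ≤ dist y x₁ := by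
    rw [edist_dist, ENNReal.ofReal_le_ofReal_iff dist_nonneg, dist_comm]
  unfold harmlessProb IsHarmless
  simp_rw [hmem]
  split_ifs with h
  · simp only [h, true_and]
    have hXm : Measurable (fun ω i => X i ω) := measurable_pi_lambda _ hX.measurable
    have hgm' : Measurable (fun ω i => g i ω) := measurable_pi_lambda _ hgm
    have hJ : Measurable (fun m : (κ → Plane) × (κ → ℝ) => interference α rg y m.1 m.2) :=
      measurable_interference α rg measurable_const measurable_fst measurable_snd
    have hcomp : ∀ J : (κ → Plane) × (κ → ℝ) → ℝ≥0∞, Measurable J →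
        IndepFun G (fun ω => J ((fun i => X i ω), (fun i => g i ω))) P :=
      fun J hJ => hGXg.comp measurable_id hJ
    have hGI : IndepFun G (fun ω => interference α rg y (fun i => X i ω) (fun i => g i ω)) P :=
      hcomp _ hJ
    have hI : Measurable (fun ω => interference α rg y (fun i => X i ω) (fun i => g i ω)) :=
      measurable_interference α rg measurable_const hXm hgm'
    rw [measure_sinr_le hα hPt hσ2 hβS hGm hG hI hGI (fun s hs =>
      lintegral_expNeg_interference hα hrg hlam hX hgm hg hind hXg y hs) y, dist_comm]
  · simp [h]

/-- Every location in the guard disc is bad, which contributes its area; outside, a location is bad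
with its decoding probability, integrated in polar coordinates. -/
lemma lintegral_one_sub_harmlessProb (hα : 2 < α) (hPt : 0 < Pt) (hσ2 : 0 ≤ σ2) (hβS : 0 < βS)
    (hrg : 0 ≤ rg) (hlam : 0 ≤ lam) (hpos : 0 < σ2 ∨ 0 < lam) :
    ∫⁻ y : Plane, (1 - harmlessProb α Pt σ2 βS rg lam (dist y x₁)) =
      ENNReal.ofReal (π * rg ^ 2) +
      ENNReal.ofReal (2 * π * ∫ r in Set.Ioi rg, secureIntegrand α Pt σ2 βS rg lam r) := by
  let F : ℝ → ℝ := (Set.Ici rg).indicator (decodeProb α Pt σ2 βS rg lam)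
  have hF : ∀ r, 0 ≤ F r := Set.indicator_nonneg fun r _ => decodeProb_nonneg _ _ _ _ _ _ r
  have hrF : (fun r => r * F r) =
      (Set.Ici rg).indicator (secureIntegrand α Pt σ2 βS rg lam) := by
    ext r
    by_cases h : r ∈ Set.Ici rg
    · simp only [F, Set.indicator_of_mem h, decodeProb, secureIntegrand]
      ring
    · simp [F, Set.indicator_of_notMem h]
  have hsec := integrableOn_secureIntegrand hα hPt hσ2 hβS hrg hlam hpos
  have hIci := (integrableOn_Ici_iff_integrableOn_Ioi (f := secureIntegrand α Pt σ2 βS rg lam)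
    (b := rg) (μ := volume)).2 hsec
  have hi : IntegrableOn (fun r => r * F r) (Set.Ioi 0) := by
    rw [hrF]
    exact ((integrable_indicator_iff measurableSet_Ici).2 hIci).integrableOn
  have hint : ∫ r in Set.Ioi 0, r * F r =
      ∫ r in Set.Ioi rg, secureIntegrand α Pt σ2 βS rg lam r := by
    rw [hrF, setIntegral_indicator measurableSet_Ici]
    refine setIntegral_congr_set ?_
    have h := (ae_eq_refl (μ := (volume : Measure ℝ)) (Set.Ioi 0)).inter
      (Ioi_ae_eq_Ici (μ := volume) (a := rg)).symm
    rwa [Set.inter_eq_self_of_subset_right (Set.Ioi_subset_Ioi hrg)] at h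
  have hpt : ∀ y : Plane, 1 - harmlessProb α Pt σ2 βS rg lam (dist y x₁) =
      (Metric.ball x₁ rg).indicator (fun _ => 1) y + ENNReal.ofReal (F (dist y x₁)) := by
    intro y
    by_cases h : rg ≤ dist y x₁
    · have h1 : ENNReal.ofReal (decodeProb α Pt σ2 βS rg lam (dist y x₁)) ≤ 1 := by
        simpa using decodeProb_le_one hα hPt hσ2 hβS hlam dist_nonneg
      rw [harmlessProb, if_pos h, ENNReal.sub_sub_cancel ENNReal.one_ne_top h1,
        Set.indicator_of_notMem (by simpa using h), zero_add]
      simp only [F]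
      rw [Set.indicator_of_mem (Set.mem_Ici.2 h)]
    · rw [harmlessProb, if_neg h, Set.indicator_of_mem (by simpa using h)]
      simp only [F]
      rw [Set.indicator_of_notMem (by simpa using h)]
      simp
  simp_rw [hpt]
  rw [lintegral_add_left (measurable_const.indicator measurableSet_ball),
    lintegral_indicator_const measurableSet_ball, one_mul, lintegral_ofReal_dist hF hi, hint,
    EuclideanSpace.volume_ball_fin_two, mul_comm, ENNReal.ofReal_mul Real.pi_pos.le,
    ENNReal.ofReal_pow hrg]

end Decode

/-! ### Guard zone and secrecy as void probabilities -/

namespace Network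

lemma mem_guardClear_iff {Ω ι κ : Type*} {N : Network Ω ι κ} {x₁ : Plane} {rg : ℝ} {ω : Ω} :
    ω ∈ N.guardClear rg x₁ ↔ ∀ j, ENNReal.ofReal rg ≤ edist x₁ (N.eve j ω) := by
  change ENNReal.ofReal rg ≤ ⨅ j, edist x₁ (N.eve j ω) ↔ _
  exact le_iInf_iff

variable {Ω ι κ : Type*} [MeasurableSpace Ω] [Countable ι] {P : Measure Ω} [IsProbabilityMeasure P]
  {N : Network Ω ι κ} {x₁ : Plane} {lamS lamP α Pt σ2 βS rg : ℝ}

lemma measurableSet_guardClear (hm : ∀ j, Measurable (N.eve j)) :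
    MeasurableSet (N.guardClear rg x₁) := by
  have : N.guardClear rg x₁ = ⋂ j, {ω | ENNReal.ofReal rg ≤ edist x₁ (N.eve j ω)} := by
    ext ω
    simp [mem_guardClear_iff]
  rw [this]
  exact MeasurableSet.iInter fun j => measurableSet_le measurable_const
    (measurable_const.edist (hm j))

lemma measure_guardClear (hrg : 0 ≤ rg) (hE : IsHomogeneousPPP N.eve lamS P) :
    P (N.guardClear rg x₁) = expNeg (ENNReal.ofReal lamS * ENNReal.ofReal (π * rg ^ 2)) := by
  classical
  have hE' : IsPoissonProcess N.eve (ENNReal.ofReal lamS • (volume : Measure Plane)) P := hE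
  have hS : MeasurableSet {x : Plane | ENNReal.ofReal rg ≤ edist x₁ x} :=
    measurableSet_le measurable_const (measurable_const.edist measurable_id)
  have h := hE'.lintegral_expNeg_tsum
    (f := fun x => if ENNReal.ofReal rg ≤ edist x₁ x then 0 else ∞)
    (Measurable.ite hS measurable_const measurable_const)
  simp_rw [expNeg_tsum_ite, ← mem_guardClear_iff] at h
  rw [lintegral_ite_one_zero P (p := fun ω => ω ∈ N.guardClear rg x₁)
    (measurableSet_guardClear hE'.measurable)] at h
  refine h.trans ?_
  have hpt : ∀ x, 1 - expNeg (if ENNReal.ofReal rg ≤ edist x₁ x then 0 else ∞) =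
      (Metric.ball x₁ rg).indicator (fun _ => 1) x := by
    intro x
    have hmem : ENNReal.ofReal rg ≤ edist x₁ x ↔ x ∉ Metric.ball x₁ rg := by
      rw [edist_dist, ENNReal.ofReal_le_ofReal_iff dist_nonneg, dist_comm, Metric.mem_ball, not_lt]
    by_cases hx : x ∈ Metric.ball x₁ rg
    · rw [if_neg (by rw [hmem, not_not]; exact hx), Set.indicator_of_mem hx]
      simp
    · rw [if_pos (hmem.2 hx), Set.indicator_of_notMem hx]
      simp
  simp_rw [hpt]
  rw [lintegral_indicator_const measurableSet_ball, one_mul, Measure.smul_apply,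
    EuclideanSpace.volume_ball_fin_two, smul_eq_mul, ENNReal.ofReal_mul Real.pi_pos.le,
    ENNReal.ofReal_pow hrg, mul_comm (ENNReal.ofReal π)]

variable [Countable κ]

/-- Bad eavesdroppers form an independent thinning, and the event says that there are none. The two
factors are the guard disc and the decoders outside it. -/
lemma measure_guardClear_inter (hlamP : 0 ≤ lamP) (hα : 2 < α) (hPt : 0 < Pt) (hσ2 : 0 ≤ σ2)
    (hβS : 0 < βS) (hrg : 0 ≤ rg) (hpos : 0 < σ2 ∨ 0 < lamP * N.activeProb P rg x₁)
    (hN : N.IsApproximateModel P lamS lamP rg x₁) :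
    P (N.guardClear rg x₁ ∩ {ω | ∀ j, N.eveSinr α Pt σ2 rg x₁ j ω ≤ ENNReal.ofReal βS}) =
      expNeg (ENNReal.ofReal lamS * ENNReal.ofReal (π * rg ^ 2)) *
      expNeg (ENNReal.ofReal lamS * ENNReal.ofReal (2 * π * ∫ r in Set.Ioi rg,
        secureIntegrand α Pt σ2 βS rg (lamP * N.activeProb P rg x₁) r)) := by
  classical
  have hE : IsPoissonProcess N.eve (ENNReal.ofReal lamS • (volume : Measure Plane)) P := hN.eve_ppp
  have hlam : 0 ≤ lamP * N.activeProb P rg x₁ := mul_nonneg hlamP measureReal_nonneg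
  have henv : ∀ j, Measurable (N.environment j) := fun j =>
    (hN.directGain_measurable j).prodMk ((measurable_pi_lambda _ (hN.interferer_ppp j).measurable).prodMk
      (measurable_pi_lambda _ (hN.crossGain_measurable j)))
  have hset : N.guardClear rg x₁ ∩ {ω | ∀ j, N.eveSinr α Pt σ2 rg x₁ j ω ≤ ENNReal.ofReal βS} =
      {ω | ∀ j, IsHarmless α Pt σ2 βS rg x₁ (N.eve j ω) (N.environment j ω)} := by
    ext ω
    rw [Set.mem_inter_iff, mem_guardClear_iff]
    exact forall_and.symm
  have hH := measurableSet_isHarmless (κ := κ) (α := α) (Pt := Pt) (σ2 := σ2) (βS := βS) (rg := rg)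
    (x₁ := x₁)
  have hmS : MeasurableSet
      {ω | ∀ j, IsHarmless α Pt σ2 βS rg x₁ (N.eve j ω) (N.environment j ω)} := by
    rw [Set.ofPred_forall]
    exact MeasurableSet.iInter fun j => ((hE.measurable j).prodMk (henv j)) hH
  -- With values 0 and ∞, exp(-∑ φ) is the indicator that all eavesdroppers are harmless.
  have hφ : Measurable (Function.uncurry fun (y : Plane) (m : ℝ × (κ → Plane) × (κ → ℝ)) =>
      if IsHarmless α Pt σ2 βS rg x₁ y m then (0 : ℝ≥0∞) else ∞) :=
    Measurable.ite hH measurable_const measurable_const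
  have hv := fun y => fun j => measure_isHarmless (x₁ := x₁) hα hPt hσ2 hβS hrg hlam
    (hN.interferer_ppp j) (hN.crossGain_measurable j) (hN.crossGain_law j) (hN.indep_crossGain j)
    (hN.indep_interferer j) (hN.directGain_measurable j) (hN.directGain_law j)
    (hN.indep_directGain j) y
  have hvm : Measurable (fun y : Plane => harmlessProb α Pt σ2 βS rg
      (lamP * N.activeProb P rg x₁) (dist y x₁)) := by
    have h1 : Measurable (harmlessProb α Pt σ2 βS rg (lamP * N.activeProb P rg x₁)) :=
      Measurable.ite measurableSet_Ici
        ((measurable_decodeProb _ _ _ _ _ _).ennreal_ofReal.const_sub 1) measurable_const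
    exact h1.comp (measurable_id.dist measurable_const)
  have hv1 : ∀ y : Plane, harmlessProb α Pt σ2 βS rg
      (lamP * N.activeProb P rg x₁) (dist y x₁) ≤ 1 := by
    intro y
    unfold harmlessProb
    split_ifs
    · exact tsub_le_self
    · exact zero_le
  have h := hE.lintegral_expNeg_tsum_mark henv hN.indep_environment hN.indep_eve_environment hφ
    hvm hv1 ?_
  · simp_rw [expNeg_tsum_ite] at h
    rw [lintegral_ite_one_zero P hmS] at h
    rw [hset, h, lintegral_smul_measure,
      lintegral_one_sub_harmlessProb hα hPt hσ2 hβS hrg hlam hpos, smul_eq_mul, mul_add, expNeg_add]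
  · intro j y
    have hmj : MeasurableSet {ω | IsHarmless α Pt σ2 βS rg x₁ y (N.environment j ω)} :=
      (henv j) (measurable_prodMk_left hH)
    refine Eq.trans ?_ ((lintegral_ite_one_zero P hmj).trans (hv y j))
    refine lintegral_congr fun ω => ?_
    split_ifs <;> simp

end Network

/-! ### Assembly of the formulas -/

theorem theorem3 {Ω ι κ : Type*} [MeasurableSpace Ω] [Countable ι] [Countable κ]
    (P : Measure Ω) [IsProbabilityMeasure P] (N : Network Ω ι κ) (x₁ : Plane)
    (lamS lamP α Pt σ2 βS rg : ℝ)
    (hlamS : 0 ≤ lamS) (hlamP : 0 ≤ lamP) (hα : 2 < α) (hPt : 0 < Pt) (hσ2 : 0 ≤ σ2)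
    (hβS : 0 < βS) (hrg : 0 ≤ rg) (hpos : 0 < σ2 ∨ 0 < lamP)
    (hN : N.IsApproximateModel P lamS lamP rg x₁) :
    -- the activity probability
    N.activeProb P rg x₁ = Real.exp (-(lamS * π * rg ^ 2)) ∧
    -- the Laplace transform of the interference, at any reference point
    (∀ (j : ι) (y : Plane), (∀ᵐ ω ∂P, N.interferenceAt α rg j y ω < ∞) ∧
      ∀ s : ℝ, 0 ≤ s →
        ∫ ω, Real.exp (-(s * (N.interferenceAt α rg j y ω).toReal)) ∂P =
          laplaceI2 α rg (lamP * N.activeProb P rg x₁) s) ∧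
    -- the integrals in the formulas converge
    (∀ s : ℝ, 0 ≤ s → IntegrableOn (zIntegrand α s) (zRange α rg s)) ∧
    IntegrableOn (secureIntegrand α Pt σ2 βS rg (lamP * N.activeProb P rg x₁)) (Set.Ioi rg) ∧
    -- the secure communication probability
    N.secureProb P α Pt σ2 βS rg x₁ =
      Real.exp (-(2 * π * lamS * ∫ r in Set.Ioi rg,
        secureIntegrand α Pt σ2 βS rg (lamP * N.activeProb P rg x₁) r)) := by
  have hact : P (N.guardClear rg x₁) = ENNReal.ofReal (Real.exp (-(lamS * π * rg ^ 2))) := by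
    rw [Network.measure_guardClear hrg hN.eve_ppp, ← ENNReal.ofReal_mul hlamS,
      expNeg_ofReal (by positivity), mul_assoc]
  have hprob : N.activeProb P rg x₁ = Real.exp (-(lamS * π * rg ^ 2)) := by
    rw [Network.activeProb, measureReal_def, hact, ENNReal.toReal_ofReal (Real.exp_nonneg _)]
  have hprob0 : 0 < N.activeProb P rg x₁ := hprob ▸ Real.exp_pos _
  have hlam : 0 ≤ lamP * N.activeProb P rg x₁ := by positivity
  have hpos' : 0 < σ2 ∨ 0 < lamP * N.activeProb P rg x₁ :=
    hpos.imp_right fun h => mul_pos h hprob0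
  refine ⟨hprob, fun j y => ?_, fun s _ => integrableOn_zIntegrand hα rg s,
    integrableOn_secureIntegrand hα hPt hσ2 hβS hrg hlam hpos', ?_⟩
  · have hI : Measurable (N.interferenceAt α rg j y) := by
      have hX : Measurable (fun ω i => N.interferer j i ω) :=
        measurable_pi_lambda _ (hN.interferer_ppp j).measurable
      have hg : Measurable (fun ω i => N.crossGain j i ω) :=
        measurable_pi_lambda _ (hN.crossGain_measurable j)
      exact measurable_interference α rg measurable_const hX hg
    have hL : ∀ s, 0 ≤ s → ∫⁻ ω, expNeg (ENNReal.ofReal s * N.interferenceAt α rg j y ω) ∂P =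
        ENNReal.ofReal (laplaceI2 α rg (lamP * N.activeProb P rg x₁) s) := fun s hs =>
      lintegral_expNeg_interference hα hrg hlam (hN.interferer_ppp j) (hN.crossGain_measurable j)
        (hN.crossGain_law j) (hN.indep_crossGain j) (hN.indep_interferer j) y hs
    have hfin := ae_lt_top_of_tendsto_lintegral_expNeg hI (fun s hs => hL s hs.le)
      (tendsto_laplaceI2 hα)
    refine ⟨hfin, fun s hs => ?_⟩
    rw [integral_exp_neg_mul_toReal hI hfin hs, hL s hs]
    exact ENNReal.toReal_ofReal (Real.exp_nonneg _)
  · have hint : 0 ≤ ∫ r in Set.Ioi rg,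
        secureIntegrand α Pt σ2 βS rg (lamP * N.activeProb P rg x₁) r :=
      setIntegral_nonneg measurableSet_Ioi fun r hr =>
        mul_nonneg (decodeProb_nonneg _ _ _ _ _ _ r) (hrg.trans (le_of_lt hr))
    have hg0 : P (N.guardClear rg x₁) ≠ 0 := by
      rw [hact]
      simpa using Real.exp_pos _
    -- The first factor of the joint probability is exactly P(guard zone clear), which is positive
    -- and cancels on conditioning.
    rw [Network.secureProb, measureReal_def,
      cond_apply (Network.measurableSet_guardClear hN.eve_ppp.measurable),
      Network.measure_guardClear_inter hlamP hα hPt hσ2 hβS hrg hpos' hN,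
      ← Network.measure_guardClear hrg hN.eve_ppp, ← mul_assoc,
      ENNReal.inv_mul_cancel hg0 (measure_ne_top _ _), one_mul, ← ENNReal.ofReal_mul hlamS,
      expNeg_ofReal (by positivity), ENNReal.toReal_ofReal (Real.exp_nonneg _)]
    congr 2
    ring
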